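/- **Order book.** Fix integers $K,\bar M\ge 0$, boundary volumes $a_\infty,|b_\infty|\in\mathbb N$ and a horizon $T$. A state is $z=(x,y,\underline a,\underline b,\underline{na},\underline{nb},\underline{ra},\underline{rb},pa,pb)$: cash $x\in\mathbb R$, inventory $y\in\mathbb Z$, ask and bid price $pa,pb\in\mathbb R$ (tick size 1); $a_i$ (resp. $|b_i|$) $\in\mathbb N$, $0\le i<K$, is the number of general participants' sell (resp. buy) orders $i+1$ ticks away from the best bid (resp. best ask); $ra_j, rb_j\in\{0,\dots,K-1\}\cup\{-1\}$, $1\le j\le\bar M$, are the limits at which the market maker's orders stand ($-1$: not placed), and $na_j,nb_j$ their ranks in the FIFO queues ($-1$: not placed). $E$ is the set of states. Let $a0(z)$ be the least $i$ with $a_i>0$ ($K$ if there is none). In state $z$ the admissible decisions are $A_z=\{(\underline{ra}',\underline{rb}')\in(\{-1,\dots,K-1\}^{\bar M})^2:\ \text{every entry}\ \ne -1\ \text{is}\ \ge a0(z)\}$. After decision $u$ the state is $\phi^u(z)$: her orders stand at the limits $u$; an order that stays at its limit keeps its place in the queue, a new one goes to the end of its queue, the others are withdrawn. General participants send unit orders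 of $4K+2$ kinds: market buy/sell, and limit and cancel orders at each limit of each side. A limit order joins the end of its queue. A cancellation at a limit removes one of the general participants' orders there, chosen uniformly (nothing happens if there is none). A market order executes the first order of the queue at the best limit; if this is the market maker's, her cash and inventory change by the traded price and one share (nothing happens if the frame of that side is empty). When the best price of a side moves, $pa$ or $pb$ follows and the opposite side is re-indexed: limits entering the frame from outside contain $a_\infty$ (resp. $|b_\infty|$) orders, limits lying at or beyond the former best price of the side that moved are empty, and orders of the market maker leaving the frame are removed. The intensities $\lambda^e\ge 0$ of the kinds $e$ depend only on $(\underline a,\underline b)$ and satisfy $\lambda^e(\underline a,\underline b)\le C(1+|\underline a|+|\underline b|)$ for some constant $C$. Put $\lambda(z)=\sum_e\lambda^e(z)$, and let $Q'(\cdot\mid z,u)=\sum_e\frac{\lambda^e(z)}{\lambda(z)}\,\mathrm{Law}\big(\text{state after event } e \text{ in state } \phi^u(z)\big)$. **Continuous-time problem.** An admissible policy is a sequence $\alpha=(f_n)_{n\ge0}$ of measurable feedback maps with $f_n(t,z)\in A_z$. Given $\alpha$ and $(t,z)\in[0,T]\times E$, let $(T_0,Z_0)=(t,z)$ and, conditionally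 on $(T_k,Z_k)_{k\le n}$, let $T_{n+1}-T_n$ be exponential with parameter $\lambda(Z_n)$ and independent of $Z_{n+1}\sim Q'(\cdot\mid Z_n,f_n(T_n,Z_n))$ (no further jump if $\lambda(Z_n)=0$). For $T_n\le s<T_{n+1}$ the control is $\alpha_s=f_n(T_n,Z_n)$ and the order book is in the state $Z_s=\phi^{\alpha_s}(Z_n)$. Let $f$ (running reward) and $g$ (terminal reward) be real and measurable, and $$V(t,z)=\sup_{\alpha}\ \mathbb E^\alpha_{t,z}\Big[\int_t^T f(\alpha_s,Z_s)\,ds+g(Z_T)\Big],$$ under the assumption that for every $(t,z)\in[0,T]\times E$ one has $\sup_\alpha\mathbb E^\alpha_{t,z}\big[\int_t^T f^+(\alpha_s,Z_s)ds\big]<\infty$, and that there are $c,d$ with $g(Z_T)\le c(1+N_T)^d$ almost surely for every $\alpha$, where $N_T$ is the number of order arrivals in $(t,T]$. (Expectations are $\mathbb E[X^+]-\mathbb E[X^-]\in[-\infty,\infty)$.) **Decision process.** The discrete-time, infinite-horizon Markov decision process has states $(t,z)\in[0,T]\times E$ and an absorbing cemetery $\Delta$, actions $A_z$, transition law $$Q(B\times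 C\mid t,z,u)=\lambda(z)\int_0^{T-t}e^{-\lambda(z)s}\mathbf 1_B(t+s)\,Q'(C\mid z,u)\,ds,\qquad Q(\{\Delta\}\mid t,z,u)=e^{-\lambda(z)(T-t)},$$ reward $0$ at $\Delta$ and $$r(t,z,u)=f(u,\phi^u(z))\Big(\frac1{\lambda(z)}-\frac{e^{-\lambda(z)(T-t)}}{\lambda(z)}\Big)+e^{-\lambda(z)(T-t)}g(\phi^u(z)),$$ where the bracket is read as $T-t$ if $\lambda(z)=0$. Its value function is $V_\infty(t,z)=\sup_{(f_n)}\mathbb E^{(f_n)}_{t,z}\big[\sum_{n\ge0}r(T_n,Z_n,f_n(T_n,Z_n))\big]$, the supremum being over the same admissible policies and the reward being $0$ once the chain has reached $\Delta$. **Proposition.** For all $(t,z)\in[0,T]\times E$: $\;V_\infty(t,z)=V(t,z)$. -/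

import Mathlib

open MeasureTheory ProbabilityTheory Set
open scoped ENNReal NNReal

noncomputable section

namespace MarketMaking

/-! ### States, actions, events -/

/-- One side of the order book, seen through a frame of `K` limits. Limit `i : Fin K` lies `i + 1`
ticks away from the best price of the opposite side. `vol i` is the number of orders of general
participants at limit `i` (for the bid side it is the absolute value of the usual signed quantity).
The market maker has `M` order slots on this side: `loc j` is the limit of her `j`-th order, with
`none` for an order that is not placed, and `rank j` is the position of that order in its FIFO
queue, counted from `1` (all orders counted, hers included), with `-1` for an order that is not
placed. -/
@[ext]
structure Side (K M : ℕ) where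
  vol : Fin K → ℕ
  loc : Fin M → Option (Fin K)
  rank : Fin M → ℤ

/-- The integer-valued part of the state: inventory of the market maker and both sides. -/
@[ext]
structure Config (K M : ℕ) where
  inv : ℤ
  ask : Side K M
  bid : Side K M

/-- State `z = ((x, pa, pb), (y, (a, ra, na), (b, rb, nb)))` of the controlled order book:
cash, ask price and bid price (tick size `1`), then the integer-valued part. -/
abbrev State (K M : ℕ) := (ℝ × ℝ × ℝ) × Config K M

/-- A decision: the limits at which the `M` sell orders and the `M` buy orders of the market maker
are to stand (`none`: not placed). -/
@[ext]
structure Action (K M : ℕ) where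
  ask : Fin M → Option (Fin K)
  bid : Fin M → Option (Fin K)

/-- The `4 K + 2` kinds of orders of the general participants. -/
inductive Event (K : ℕ)
  | marketBuy
  | marketSell
  | limitAsk (i : Fin K)
  | limitBid (i : Fin K)
  | cancelAsk (i : Fin K)
  | cancelBid (i : Fin K)
  deriving DecidableEq, Fintype

instance (K M : ℕ) : Inhabited (Side K M) := ⟨⟨fun _ => 0, fun _ => none, fun _ => -1⟩⟩
instance (K M : ℕ) : Inhabited (Config K M) := ⟨⟨0, default, default⟩⟩
instance (K M : ℕ) : Inhabited (Action K M) := ⟨⟨fun _ => none, fun _ => none⟩⟩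

instance (K M : ℕ) : Countable (Side K M) :=
  Function.Injective.countable (f := fun s : Side K M => (s.vol, s.loc, s.rank)) (by
    rintro ⟨_, _, _⟩ ⟨_, _, _⟩ h; simpa using h)

instance (K M : ℕ) : Countable (Config K M) :=
  Function.Injective.countable (f := fun c : Config K M => (c.inv, c.ask, c.bid)) (by
    rintro ⟨_, _, _⟩ ⟨_, _, _⟩ h; simpa using h)

instance (K M : ℕ) : Countable (Action K M) :=
  Function.Injective.countable (f := fun a : Action K M => (a.ask, a.bid)) (by
    rintro ⟨_, _⟩ ⟨_, _⟩ h; simpa using h)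

instance (K M : ℕ) : MeasurableSpace (Config K M) := ⊤
instance (K M : ℕ) : DiscreteMeasurableSpace (Config K M) := ⟨fun _ => trivial⟩
instance (K M : ℕ) : MeasurableSpace (Action K M) := ⊤
instance (K M : ℕ) : DiscreteMeasurableSpace (Action K M) := ⟨fun _ => trivial⟩

/-! ### Mechanics of one side of the book -/

/-- Index of the best limit: the first limit with an order of a general participant, and `K` if
there is none inside the frame. -/
def best {K : ℕ} (v : Fin K → ℕ) : ℕ := sInf {n : ℕ | ∀ h : n < K, 0 < v ⟨n, h⟩}

namespace Side

variable {K M : ℕ} (s : Side K M)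

/-- Number of orders of general participants that stand before the `j`-th order of the market maker
in its queue. -/
def generalAhead (j : Fin M) : ℤ :=
  s.rank j - 1 - Nat.card {i : Fin M // s.loc i = s.loc j ∧ s.rank i < s.rank j}

/-- Re-indexing when the best price of the opposite side moves away by `d` ticks (`d < 0`: comes
closer by `-d` ticks): the order that was at limit `i` is now at limit `i + d`. Limits that enter
the frame from outside contain `vInf` orders; limits that were at or beyond the opposite best price are
empty; orders of the market maker that leave the frame are removed. -/
def shift (d : ℤ) (vInf : ℕ) : Side K M :=
  let loc' : Fin M → Option (Fin K) := fun j =>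
    (s.loc j).bind fun l =>
      if h : 0 ≤ (l : ℤ) + d ∧ (l : ℤ) + d < K then some ⟨((l : ℤ) + d).toNat, by omega⟩ else none
  { vol := fun j =>
      if (j : ℤ) - d < 0 then 0
      else if h : (j : ℤ) - d < K ∧ 0 ≤ (j : ℤ) - d then s.vol ⟨((j : ℤ) - d).toNat, by omega⟩
      else vInf
    loc := loc'
    rank := fun j => if loc' j = none then -1 else s.rank j }

/-- A limit order of a general participant arrives at limit `i`, at the end of the queue. -/
def add (i : Fin K) : Side K M := { s with vol := Function.update s.vol i (s.vol i + 1) }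

open Classical in
/-- Among the orders of the general participants at limit `i`, the one which has exactly `k` of them
before it is cancelled. (Nothing happens if limit `i` holds no such order and `k = 0`.) -/
def cancel (i : Fin K) (k : ℕ) : Side K M :=
  { vol := Function.update s.vol i (s.vol i - 1)
    loc := s.loc
    rank := fun j =>
      if s.loc j = some i ∧ (k : ℤ) < s.generalAhead j then s.rank j - 1 else s.rank j }

/-- The `j`-th order of the market maker stands at the best limit. -/
def AtBest (j : Fin M) : Prop := ∃ l, s.loc j = some l ∧ (l : ℕ) = best s.vol

/-- The `j`-th order of the market maker is the first one of the queue at the best limit. (At most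
one of her orders has this rank; the minimality over slots makes this so for every element of the
type.) -/
def Front (j : Fin M) : Prop :=
  (s.AtBest j ∧ s.rank j = 1) ∧ ∀ i < j, ¬ (s.AtBest i ∧ s.rank i = 1)

/-- The next market order is executed against an order of the market maker. -/
def Hits : Prop := ∃ j, s.Front j

open Classical in
/-- A market order of size one executes the first order of the queue at the best limit. -/
def execute : Side K M :=
  { vol := fun i => if (i : ℕ) = best s.vol ∧ ¬ s.Hits then s.vol i - 1 else s.vol i
    loc := fun j => if s.Front j then none else s.loc j
    rank := fun j =>
      if s.Front j then -1 else if s.AtBest j then s.rank j - 1 else s.rank j }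

open Classical in
/-- The market maker places her orders at the limits `new`. An order that stays at its limit keeps
its place in the queue; any other placed order is new and goes to the end of its queue (in the order
of the slots); all the other orders of hers are withdrawn. -/
def place (new : Fin M → Option (Fin K)) : Side K M :=
  let ahead : Fin M → Fin M → Prop := fun i j =>
    new i = new j ∧
      if s.loc i = new i then (s.loc j = new j → s.rank i < s.rank j)
      else ¬ s.loc j = new j ∧ i < j
  { vol := s.vol
    loc := new
    rank := fun j =>
      match new j with
      | none => -1
      | some l =>
        (if s.loc j = some l then s.generalAhead j else (s.vol l : ℤ)) + 1
          + Nat.card {i : Fin M // ahead i j} }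

end Side

/-! ### Decisions of the market maker -/

/-- `φ^a(z)`: the state right after the decision `a`. -/
def afterDecision {K M : ℕ} (a : Action K M) (z : State K M) : State K M :=
  (z.1, { z.2 with ask := z.2.ask.place a.ask, bid := z.2.bid.place a.bid })

/-- The set `A_z` of the admissible decisions: all the placed orders stand at the index of the best
limit or further, so that the spread is not crossed. (In the frame, the index of the best limit is
the spread, the same one for the two sides.) -/
def admissible {K M : ℕ} (z : State K M) : Set (Action K M) :=
  {a | ∀ j l, (a.ask j = some l ∨ a.bid j = some l) → best z.2.ask.vol ≤ l}

/-! ### The model -/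

/-- Data of a market-making problem: the boundary conditions `a_∞` and `|b_∞|`, the intensities of
the orders of the general participants as functions of the volumes `(a, |b|)`, the horizon, the
running reward and the terminal reward. -/
structure Model (K M : ℕ) where
  askInf : ℕ
  bidInf : ℕ
  intensity : Event K → (Fin K → ℕ) → (Fin K → ℕ) → ℝ≥0
  T : ℝ
  f : Action K M → State K M → ℝ
  g : State K M → ℝ

namespace Model

variable {K M : ℕ} (m : Model K M)

/-- The ask side becomes `s`: the ask price follows the best ask limit and the bid side, whose
limits are counted from the ask price, is re-indexed. -/
def setAsk (z : State K M) (s : Side K M) : State K M :=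
  let d : ℤ := (best s.vol : ℤ) - best z.2.ask.vol
  ((z.1.1, z.1.2.1 + d, z.1.2.2), { inv := z.2.inv, ask := s, bid := z.2.bid.shift d m.bidInf })

/-- The bid side becomes `s`. -/
def setBid (z : State K M) (s : Side K M) : State K M :=
  let d : ℤ := (best s.vol : ℤ) - best z.2.bid.vol
  ((z.1.1, z.1.2.1, z.1.2.2 - d), { inv := z.2.inv, ask := z.2.ask.shift d m.askInf, bid := s })

/-- The market maker trades `n` shares at price `p` per share (`n < 0`: she sells). -/
def trade (z : State K M) (n : ℤ) (p : ℝ) : State K M :=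
  ((z.1.1 - n * p, z.1.2.1, z.1.2.2), { z.2 with inv := z.2.inv + n })

open Classical in
/-- State after the arrival of the order `e`, where `k` is the position (among the orders of the
general participants) of the cancelled order if `e` is a cancellation, and is not used otherwise. -/
def outcome (e : Event K) (k : ℕ) (z : State K M) : State K M :=
  match e with
  | .marketBuy =>
      m.setAsk (if z.2.ask.Hits then trade z (-1) z.1.2.1 else z) z.2.ask.execute
  | .marketSell =>
      m.setBid (if z.2.bid.Hits then trade z 1 z.1.2.2 else z) z.2.bid.execute
  | .limitAsk i => m.setAsk z (z.2.ask.add i)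
  | .limitBid i => m.setBid z (z.2.bid.add i)
  | .cancelAsk i => m.setAsk z (z.2.ask.cancel i k)
  | .cancelBid i => m.setBid z (z.2.bid.cancel i k)

/-- Number of equally likely values of `k` in `outcome`: the cancelled order is uniformly
distributed among the orders of the general participants at its limit. -/
def choices (e : Event K) (c : Config K M) : ℕ :=
  match e with
  | .cancelAsk i => max 1 (c.ask.vol i)
  | .cancelBid i => max 1 (c.bid.vol i)
  | _ => 1

/-- Law of the state after the arrival of the order `e` in state `z`. -/
def eventLaw (e : Event K) (z : State K M) : Measure (State K M) :=
  ∑ k ∈ Finset.range (choices e z.2), ((choices e z.2 : ℝ≥0∞))⁻¹ • Measure.dirac (m.outcome e k z)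

/-- Intensity of the order `e` in a state. -/
def rate (e : Event K) (c : Config K M) : ℝ≥0 := m.intensity e c.ask.vol c.bid.vol

/-- `λ(z)`: total intensity. -/
def totalRate (c : Config K M) : ℝ≥0 := ∑ e, m.rate e c

/-- `Q'(· | z, a)`: law of the state right after the next arrival, when decision `a` was taken in
state `z` (used only where `λ(z) ≠ 0`). -/
def jumpLaw (z : State K M) (a : Action K M) : Measure (State K M) :=
  ∑ e, ((m.rate e z.2 / m.totalRate z.2 : ℝ≥0) : ℝ≥0∞) • m.eventLaw e (afterDecision a z)

/-! ### One-step laws -/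

end Model

/-- Values of the embedded chains: `inl (t, z)` stands for a jump at time `t` with post-jump state
`z`. The point `inr ()` is a cemetery: in the continuous-time problem it means that no further order
ever arrives, in the decision process that the horizon was passed. -/
abbrev Node (K M : ℕ) := (ℝ × State K M) ⊕ Unit

namespace Model

variable {K M : ℕ} (m : Model K M)

open Classical in
/-- Law of the next jump time and post-jump state after a jump at time `t` to state `z` and decision
`a`: the waiting time is exponential with parameter `λ(z)` and independent of the new state. If
`λ(z) = 0` there is no further jump. -/
def nextJump (p : ℝ × State K M) (a : Action K M) : Measure (Node K M) :=
  if m.totalRate p.2.2 = 0 then Measure.dirac (Sum.inr ())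
  else ((expMeasure (m.totalRate p.2.2)).prod (m.jumpLaw p.2 a)).map
    fun q => Sum.inl (p.1 + q.1, q.2)

/-- Transition law of the decision process: for Borel sets `B`, `C`,
`Q(B × C | t, z, a) = λ(z) ∫_0^{T-t} e^{-λ(z) s} 1_B(t + s) Q'(C | z, a) ds`, and the remaining mass
`e^{-λ(z) (T - t)}` sits at the cemetery. -/
def mdpLaw (p : ℝ × State K M) (a : Action K M) : Measure (Node K M) :=
  (((volume.restrict (Ioc 0 (m.T - p.1))).withDensity fun s =>
      ENNReal.ofReal (m.totalRate p.2.2 * Real.exp (-(m.totalRate p.2.2 * s)))).prod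
      (m.jumpLaw p.2 a)).map (fun q => Sum.inl (p.1 + q.1, q.2))
    + ENNReal.ofReal (Real.exp (-(m.totalRate p.2.2 * max (m.T - p.1) 0)))
      • Measure.dirac (Sum.inr ())

/-! ### Measurability and total mass of the one-step laws -/

lemma measurable_of_config {α β : Type*} [MeasurableSpace α] [MeasurableSpace β]
    {F : α × State K M → β} (h : ∀ c, Measurable fun q : α × (ℝ × ℝ × ℝ) => F (q.1, q.2, c)) :
    Measurable F := by
  have h1 : Measurable fun q : (α × (ℝ × ℝ × ℝ)) × Config K M => F (q.1.1, q.1.2, q.2) :=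
    measurable_from_prod_countable_left h
  have h2 : Measurable fun q : α × State K M => ((q.1, q.2.1), q.2.2) := by fun_prop
  exact h1.comp h2

lemma measurable_outcome (e : Event K) (k : ℕ) (c : Config K M) :
    Measurable fun r : ℝ × ℝ × ℝ => m.outcome e k (r, c) := by
  classical
  cases e <;> simp only [outcome, setAsk, setBid, trade] <;> (try split_ifs) <;>
    (try dsimp only) <;> fun_prop

lemma measurable_jumpLaw (a : Action K M) (c : Config K M) :
    Measurable fun r : ℝ × ℝ × ℝ => m.jumpLaw (r, c) a := by
  refine Measure.measurable_of_measurable_coe _ fun B hB => ?_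
  simp only [jumpLaw, eventLaw, afterDecision, Measure.coe_finsetSum, Finset.sum_apply,
    Measure.smul_apply, smul_eq_mul]
  refine Finset.measurable_sum _ fun e _ => Measurable.const_mul ?_ _
  refine Finset.measurable_sum _ fun k _ => Measurable.const_mul ?_ _
  exact (Measure.measurable_coe hB).comp
    (Measure.measurable_dirac.comp (m.measurable_outcome e k _))

lemma isProbabilityMeasure_eventLaw (e : Event K) (z : State K M) :
    IsProbabilityMeasure (m.eventLaw e z) := by
  have h : choices e z.2 ≠ 0 := by cases e <;> simp [choices]
  refine ⟨?_⟩
  simp only [eventLaw, Measure.coe_finsetSum, Finset.sum_apply, Measure.smul_apply, smul_eq_mul,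
    measure_univ, mul_one, Finset.sum_const, Finset.card_range, nsmul_eq_mul]
  exact ENNReal.mul_inv_cancel (by exact_mod_cast h) (ENNReal.natCast_ne_top _)

lemma isProbabilityMeasure_jumpLaw (z : State K M) (a : Action K M) (h : m.totalRate z.2 ≠ 0) :
    IsProbabilityMeasure (m.jumpLaw z a) := by
  have h1 := fun e => m.isProbabilityMeasure_eventLaw e (afterDecision a z)
  refine ⟨?_⟩
  simp only [jumpLaw, Measure.coe_finsetSum, Finset.sum_apply, Measure.smul_apply, smul_eq_mul,
    measure_univ, mul_one]
  rw [← ENNReal.ofNNReal_finsetSum, ← Finset.sum_div]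
  change ((m.totalRate z.2 / m.totalRate z.2 : ℝ≥0) : ℝ≥0∞) = 1
  rw [div_self h, ENNReal.coe_one]

instance (z : State K M) (a : Action K M) : IsFiniteMeasure (m.jumpLaw z a) := by
  have h1 := fun e => m.isProbabilityMeasure_eventLaw e (afterDecision a z)
  refine ⟨?_⟩
  simp only [jumpLaw, Measure.coe_finsetSum, Finset.sum_apply, Measure.smul_apply, smul_eq_mul,
    measure_univ, mul_one]
  exact ENNReal.sum_lt_top.2 fun e _ => ENNReal.coe_lt_top

lemma measurable_map_prod {α β : Type*} [MeasurableSpace α] [MeasurableSpace β]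
    (t : α → ℝ) (ht : Measurable t) (ν : α → Measure ℝ) (hν : Measurable ν)
    (ρ : α → Measure β) (hρ : Measurable ρ) (C : ℝ≥0∞) (hC : C < ∞)
    (hν1 : ∀ x, ν x univ ≤ C) (hρ1 : ∀ x, ρ x univ ≤ C) :
    Measurable fun x => ((ν x).prod (ρ x)).map
      fun q => (Sum.inl (t x + q.1, q.2) : (ℝ × β) ⊕ Unit) := by
  let κ : Kernel α ℝ := ⟨ν, hν⟩
  let η : Kernel α β := ⟨ρ, hρ⟩
  have : IsFiniteKernel κ := ⟨⟨C, hC, hν1⟩⟩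
  have : IsFiniteKernel η := ⟨⟨C, hC, hρ1⟩⟩
  let ζ := Kernel.map (Kernel.deterministic t ht ×ₖ (κ ×ₖ η))
    fun q => (Sum.inl (q.1 + q.2.1, q.2.2) : (ℝ × β) ⊕ Unit)
  have hm : Measurable fun q : ℝ × ℝ × β => (Sum.inl (q.1 + q.2.1, q.2.2) : (ℝ × β) ⊕ Unit) :=
    measurable_inl.comp (by fun_prop)
  have key : (fun x => ((ν x).prod (ρ x)).map
      fun q => (Sum.inl (t x + q.1, q.2) : (ℝ × β) ⊕ Unit)) = ζ := by
    funext x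
    have h1 : IsFiniteMeasure (ν x) := ⟨(hν1 x).trans_lt hC⟩
    have h2 : IsFiniteMeasure (ρ x) := ⟨(hρ1 x).trans_lt hC⟩
    change _ = (Kernel.map _ _) x
    rw [Kernel.map_apply _ hm, Kernel.prod_apply, Kernel.prod_apply, Kernel.deterministic_apply,
      Measure.dirac_prod, Measure.map_map hm (by fun_prop)]
    rfl
  rw [key]
  exact ζ.measurable

lemma measurable_nextJump (a : Action K M) : Measurable fun p => m.nextJump p a := by
  refine measurable_of_config fun c => ?_
  by_cases h : m.totalRate c = 0
  · simp only [nextJump, h, if_true]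
    exact measurable_const
  · simp only [nextJump, h, if_false]
    have := isProbabilityMeasure_expMeasure (r := m.totalRate c)
      (by exact_mod_cast pos_iff_ne_zero.2 h)
    have h2 := fun r : ℝ × ℝ × ℝ => m.isProbabilityMeasure_jumpLaw (r, c) a h
    exact measurable_map_prod (fun q : ℝ × (ℝ × ℝ × ℝ) => q.1) measurable_fst _ measurable_const
      _ ((m.measurable_jumpLaw a c).comp measurable_snd) 1 (by simp)
      (fun _ => prob_le_one) (fun _ => prob_le_one)

lemma isProbabilityMeasure_nextJump (p : ℝ × State K M) (a : Action K M) :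
    IsProbabilityMeasure (m.nextJump p a) := by
  unfold nextJump
  split_ifs with h
  · infer_instance
  · have := isProbabilityMeasure_expMeasure (r := m.totalRate p.2.2)
      (by exact_mod_cast pos_iff_ne_zero.2 h)
    have := m.isProbabilityMeasure_jumpLaw p.2 a h
    exact Measure.isProbabilityMeasure_map (measurable_inl.comp (by fun_prop)).aemeasurable

lemma integral_density (l : ℝ≥0) (τ : ℝ) :
    ((volume.restrict (Ioc 0 τ)).withDensity fun s =>
      ENNReal.ofReal (l * Real.exp (-(l * s)))) univ
      = ENNReal.ofReal (1 - Real.exp (-(l * max τ 0))) := by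
  rw [withDensity_apply _ MeasurableSet.univ, Measure.restrict_univ]
  rcases le_or_gt τ 0 with h | h
  · simp [h]
  have hc : Continuous fun s : ℝ => (l : ℝ) * Real.exp (-(l * s)) := by fun_prop
  rw [← ofReal_integral_eq_lintegral_ofReal
      (hc.integrableOn_Icc.mono_set Ioc_subset_Icc_self)
      (Filter.Eventually.of_forall fun s => by positivity),
    ← intervalIntegral.integral_of_le h.le, max_eq_left h.le]
  congr 1
  have hd : ∀ s ∈ uIcc 0 τ, HasDerivAt (fun s : ℝ => -Real.exp (-(l * s)))
      (l * Real.exp (-(l * s))) s := by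
    intro s _
    have h1 : HasDerivAt (fun s : ℝ => -((l : ℝ) * s)) (-(l * 1)) s :=
      ((hasDerivAt_id s).const_mul (l : ℝ)).neg
    exact h1.exp.neg.congr_deriv (by ring)
  rw [intervalIntegral.integral_eq_sub_of_hasDerivAt hd (hc.intervalIntegrable _ _)]
  simp
  ring

lemma measurable_mdpLaw (a : Action K M) : Measurable fun p => m.mdpLaw p a := by
  refine measurable_of_config fun c => ?_
  unfold mdpLaw
  have hle : ∀ τ : ℝ, ((volume.restrict (Ioc 0 τ)).withDensity fun s =>
      ENNReal.ofReal (m.totalRate c * Real.exp (-(m.totalRate c * s)))) univ ≤ 1 := by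
    intro τ
    rw [integral_density, ENNReal.ofReal_le_one]
    linarith [Real.exp_pos (-(m.totalRate c * max τ 0))]
  have hν : Measurable fun t : ℝ => (volume.restrict (Ioc 0 (m.T - t))).withDensity fun s =>
      ENNReal.ofReal (m.totalRate c * Real.exp (-(m.totalRate c * s))) := by
    refine Measure.measurable_of_measurable_coe _ fun B hB => ?_
    have : (fun t : ℝ => ((volume.restrict (Ioc 0 (m.T - t))).withDensity fun s =>
        ENNReal.ofReal (m.totalRate c * Real.exp (-(m.totalRate c * s)))) B)
        = fun t => ∫⁻ s, ({q : ℝ × ℝ | q.2 ∈ B ∧ 0 < q.2 ∧ q.2 ≤ m.T - q.1}.indicator (fun q =>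
          ENNReal.ofReal (m.totalRate c * Real.exp (-(m.totalRate c * q.2))))) (t, s) := by
      funext t
      rw [withDensity_apply _ hB, Measure.restrict_restrict hB,
        ← lintegral_indicator (hB.inter measurableSet_Ioc)]
      rfl
    rw [this]
    refine Measurable.lintegral_prod_right' (Measurable.indicator (by fun_prop) ?_)
    exact (measurable_snd hB).inter ((measurableSet_lt measurable_const measurable_snd).inter
      (measurableSet_le measurable_snd (by fun_prop)))
  have hadd : ∀ {F G : ℝ × (ℝ × ℝ × ℝ) → Measure (Node K M)}, Measurable F → Measurable G →
      Measurable fun q => F q + G q := by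
    intro F G hF hG
    refine Measure.measurable_of_measurable_coe _ fun B hB => ?_
    simp only [Measure.add_apply]
    exact ((Measure.measurable_coe hB).comp hF).add ((Measure.measurable_coe hB).comp hG)
  refine hadd ?_ ?_
  · by_cases h : m.totalRate c = 0
    · simp only [h, NNReal.coe_zero, zero_mul, ENNReal.ofReal_zero, withDensity_const, zero_smul,
        Measure.zero_prod, Measure.map_zero]
      exact measurable_const
    · have h2 := fun r : ℝ × ℝ × ℝ => m.isProbabilityMeasure_jumpLaw (r, c) a h
      exact measurable_map_prod (fun q : ℝ × (ℝ × ℝ × ℝ) => q.1) measurable_fst _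
        (hν.comp measurable_fst) _ ((m.measurable_jumpLaw a c).comp measurable_snd) 1 (by simp)
        (fun _ => hle _) (fun _ => prob_le_one)
  · refine Measure.measurable_of_measurable_coe _ fun B hB => ?_
    simp only [Measure.smul_apply, smul_eq_mul]
    exact Measurable.mul_const (by fun_prop) _

lemma isProbabilityMeasure_mdpLaw (p : ℝ × State K M) (a : Action K M) :
    IsProbabilityMeasure (m.mdpLaw p a) := by
  have hm : Measurable fun q : ℝ × State K M => (Sum.inl (p.1 + q.1, q.2) : Node K M) :=
    measurable_inl.comp (by fun_prop)
  refine ⟨?_⟩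
  rw [mdpLaw, Measure.add_apply, Measure.map_apply hm MeasurableSet.univ, preimage_univ,
    ← univ_prod_univ, Measure.prod_prod, integral_density, Measure.smul_apply,
    measure_univ (μ := Measure.dirac _), smul_eq_mul, mul_one]
  have hexp : Real.exp (-(m.totalRate p.2.2 * max (m.T - p.1) 0)) ≤ 1 := by
    rw [Real.exp_le_one_iff]
    have : 0 ≤ max (m.T - p.1) 0 := le_max_right _ _
    have := mul_nonneg (m.totalRate p.2.2).coe_nonneg this
    linarith
  by_cases h : m.totalRate p.2.2 = 0
  · simp [h]
  · have := m.isProbabilityMeasure_jumpLaw p.2 a h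
    rw [measure_univ, mul_one, ← ENNReal.ofReal_add (by linarith) (Real.exp_pos _).le]
    simp

end Model

/-! ### Policies and laws of the chains -/

/-- An admissible (feedback) policy `(f_n)`: the decision taken at the `n`-th jump time `T_n` is
`f_n(T_n, Z_n)`. (Its values at times outside `[0, T]` play no role.) -/
structure Policy (K M : ℕ) where
  rule : ℕ → ℝ × State K M → Action K M
  measurable : ∀ n, Measurable (rule n)
  mem : ∀ n t z, rule n (t, z) ∈ admissible z

namespace Policy

variable {K M : ℕ} (α : Policy K M)

/-- Step `n → n + 1` of the chain obtained from a family of one-step laws; the cemetery is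
absorbing. -/
def step (L : ℝ × State K M → Action K M → Measure (Node K M))
    (hL : ∀ a, Measurable fun p => L p a) (n : ℕ) : Kernel (Node K M) (Node K M) where
  toFun := Sum.elim (fun p => L p (α.rule n p)) fun u => Measure.dirac (Sum.inr u)
  measurable' := by
    refine Measurable.sumElim ?_ (Measure.measurable_dirac.comp measurable_inr)
    have h : Measurable fun q : (ℝ × State K M) × Action K M => L q.1 q.2 :=
      measurable_from_prod_countable_left hL
    exact h.comp (measurable_id.prodMk (α.measurable n))

lemma isMarkovKernel_step (L : ℝ × State K M → Action K M → Measure (Node K M))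
    (hL : ∀ a, Measurable fun p => L p a) (hP : ∀ p a, IsProbabilityMeasure (L p a)) (n : ℕ) :
    IsMarkovKernel (α.step L hL n) := by
  refine ⟨?_⟩
  rintro (p | u)
  · exact hP p _
  · exact (inferInstance : IsProbabilityMeasure (Measure.dirac (Sum.inr u : Node K M)))

/-- Law on the sequences of nodes of the chain that starts at `(t, z)`. -/
def chainLaw (L : ℝ × State K M → Action K M → Measure (Node K M))
    (hL : ∀ a, Measurable fun p => L p a) (hP : ∀ p a, IsProbabilityMeasure (L p a))
    (t : ℝ) (z : State K M) : Measure (ℕ → Node K M) :=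
  haveI := α.isMarkovKernel_step L hL hP
  Kernel.traj (X := fun _ => Node K M)
    (fun n => (α.step L hL n).comap (fun h : (i : Finset.Iic n) → Node K M =>
      h ⟨n, Finset.mem_Iic.2 le_rfl⟩) (measurable_pi_apply _)) 0 (fun _ => Sum.inl (t, z))

end Policy

/-- Expectation of a real random variable as an extended real number, `E[X⁺] - E[X⁻]`; it is the
usual one as soon as one of the two terms is finite. -/
def expectation {Ω : Type*} [MeasurableSpace Ω] (P : Measure Ω) (X : Ω → ℝ) : EReal :=
  ((∫⁻ ω, ENNReal.ofReal (X ω) ∂P : ℝ≥0∞) : EReal)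
    - ((∫⁻ ω, ENNReal.ofReal (-X ω) ∂P : ℝ≥0∞) : EReal)

/-! ### The continuous-time problem -/

/-- Number of arrivals after the initial time and up to time `s`: the largest `n` with `T_n ≤ s`. -/
def arrivals {K M : ℕ} (ω : ℕ → Node K M) (s : ℝ) : ℕ :=
  sSup {n | ∃ p, ω n = Sum.inl p ∧ p.1 ≤ s}

/-- Control and state `(α_s, Z_s)` at time `s`. For `T_n ≤ s < T_{n+1}` the decision
`a = f_n(T_n, Z_n)` is in force and the order book is in state `φ^a(Z_n)`. (The default value is not
used at times after the initial one.) -/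
def current {K M : ℕ} (α : Policy K M) (ω : ℕ → Node K M) (s : ℝ) : Action K M × State K M :=
  match ω (arrivals ω s) with
  | .inl p =>
      (α.rule (arrivals ω s) p, afterDecision (α.rule (arrivals ω s) p) p.2)
  | .inr _ => default

namespace Model

variable {K M : ℕ} (m : Model K M)

/-- The law `P^α_{t,z}` of the jump times and post-jump states of the controlled order book. -/
def law (α : Policy K M) (t : ℝ) (z : State K M) : Measure (ℕ → Node K M) :=
  α.chainLaw m.nextJump m.measurable_nextJump m.isProbabilityMeasure_nextJump t z

/-- Value function of the market-making problem:
`V(t, z) = sup_α E^α_{t,z}[∫_t^T f(α_s, Z_s) ds + g(Z_T)]`. -/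
def value (t : ℝ) (z : State K M) : EReal :=
  ⨆ α : Policy K M, expectation (m.law α t z) fun ω =>
    (∫ s in t..m.T, m.f (current α ω s).1 (current α ω s).2) + m.g (current α ω m.T).2

/-! ### The Markov decision process -/

/-- The law of the chain `(T_n, Z_n)` of the decision process. -/
def mdpChain (α : Policy K M) (t : ℝ) (z : State K M) : Measure (ℕ → Node K M) :=
  α.chainLaw m.mdpLaw m.measurable_mdpLaw m.isProbabilityMeasure_mdpLaw t z

open Classical in
/-- The reward `r(t, z, a)` of one step of the decision process:
`c(z, a) (1 / λ(z) - e^{-λ(z) (T - t)} / λ(z)) + e^{-λ(z) (T - t)} g` for `t ≤ T`, where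
`c(z, a)` is the running reward and `g` the terminal reward in the state `φ^a(z)` held after the
decision; for `λ(z) = 0` the first factor is read as its limit `T - t`. -/
def reward (t : ℝ) (z : State K M) (a : Action K M) : ℝ :=
  let l : ℝ := m.totalRate z.2
  if t ≤ m.T then
    m.f a (afterDecision a z) *
        (if l = 0 then m.T - t else 1 / l - Real.exp (-(l * (m.T - t))) / l)
      + Real.exp (-(l * (m.T - t))) * m.g (afterDecision a z)
  else 0

/-- The reward collected at step `n`; it is zero at the cemetery. -/
def stepReward (α : Policy K M) (ω : ℕ → Node K M) (n : ℕ) : ℝ :=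
  Sum.elim (fun p => m.reward p.1 p.2 (α.rule n p)) (fun _ => 0) (ω n)

/-- Value function of the decision process with infinite horizon:
`V_∞(t, z) = sup_{(f_n)} E[∑_{n ≥ 0} r(T_n, Z_n, f_n(T_n, Z_n))]`. -/
def mdpValue (t : ℝ) (z : State K M) : EReal :=
  ⨆ α : Policy K M, expectation (m.mdpChain α t z) fun ω => ∑' n, m.stepReward α ω n

/-! ### Assumptions -/

/-- The intensities grow at most linearly in the volumes of the book. -/
def LinearIntensities : Prop :=
  ∃ C : ℝ, ∀ (e : Event K) (a b : Fin K → ℕ),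
    (m.intensity e a b : ℝ) ≤ C * (1 + ∑ i, (a i : ℝ) + ∑ i, (b i : ℝ))

/-- Assumption on the rewards for the initial condition `(t, z)`: the expected positive part of the
running reward is bounded uniformly in the policy, and the terminal reward is almost surely at most
of polynomial (for instance linear) growth in the number of arrivals. -/
def RewardBounds (t : ℝ) (z : State K M) : Prop :=
  (⨆ α : Policy K M, ∫⁻ ω, (∫⁻ s in Icc t m.T,
      ENNReal.ofReal (m.f (current α ω s).1 (current α ω s).2)) ∂(m.law α t z)) < ∞ ∧
  ∃ (c : ℝ) (d : ℕ), ∀ α : Policy K M, ∀ᵐ ω ∂(m.law α t z),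
    m.g (current α ω m.T).2 ≤ c * (1 + (arrivals ω m.T : ℝ)) ^ d

end Model

end MarketMaking

end

/-!
Fix a policy. The jump chain, killed at the first jump after the horizon, is the chain of the
decision process, so the running reward splits into the rewards collected between successive jumps;
the terminal reward is collected in the period in which the horizon falls. Integrating out the
exponential waiting time turns the reward of a period into the one-period reward `r` at its initial
node. Sums and expectations are interchanged separately for the positive and the negative parts of
the rewards, of which the former have a finite expectation.

That expectation is finite because the book grows by at most one order per arrival: the `n`-th
waiting time is stochastically larger than an exponential one with parameter `L (n + 1)`, and the
Laplace transform of the `n`-th jump time shows that the number of arrivals before the horizon has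
moments of every order.
-/

noncomputable section

namespace MarketMaking

/-! ### Extended expectations -/

section Expectation

variable {Ω : Type*} [MeasurableSpace Ω] {P : Measure Ω}

lemma coe_sub_coe_eq_of_add_eq_add {a b x y : ℝ≥0∞} (ha : a ≠ ∞) (hx : x ≠ ∞)
    (h : x + b = a + y) : (x : EReal) - y = (a : EReal) - b := by
  lift a to ℝ≥0 using ha
  lift x to ℝ≥0 using hx
  have hby : b = ∞ ↔ y = ∞ := by
    simpa using congrArg (· = ∞) h
  by_cases hb : b = ∞
  · rw [hb, hby.1 hb]
    rfl
  · lift y to ℝ≥0 using fun hy => hb (hby.2 hy)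
    lift b to ℝ≥0 using hb
    have h' : (x : ℝ) - y = a - b := by
      have : (x : ℝ) + b = a + y := mod_cast h
      linarith
    change ((x : ℝ) : EReal) - ((y : ℝ) : EReal) = ((a : ℝ) : EReal) - ((b : ℝ) : EReal)
    exact mod_cast h'

lemma expectation_congr_ae {X Y : Ω → ℝ} (h : X =ᵐ[P] Y) : expectation P X = expectation P Y := by
  rw [expectation, expectation,
    lintegral_congr_ae (h.mono fun ω hω => show ENNReal.ofReal (X ω) = .ofReal (Y ω) by rw [hω]),
    lintegral_congr_ae (h.mono fun ω hω => show ENNReal.ofReal (-X ω) = .ofReal (-Y ω) by rw [hω])]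

lemma expectation_map {Ω' : Type*} [MeasurableSpace Ω'] {φ : Ω → Ω'} (hφ : Measurable φ)
    {X : Ω' → ℝ} (hX : Measurable X) : expectation (P.map φ) X = expectation P (X ∘ φ) := by
  rw [expectation, expectation, lintegral_map (by fun_prop) hφ, lintegral_map (by fun_prop) hφ]
  rfl

lemma expectation_sub {A B : Ω → ℝ} (hA : Measurable A) (hB : Measurable B)
    (hA0 : 0 ≤ᵐ[P] A) (hB0 : 0 ≤ᵐ[P] B) (hfin : ∫⁻ ω, ENNReal.ofReal (A ω) ∂P ≠ ∞) :
    expectation P (fun ω => A ω - B ω) = ((∫⁻ ω, ENNReal.ofReal (A ω) ∂P : ℝ≥0∞) : EReal)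
      - ((∫⁻ ω, ENNReal.ofReal (B ω) ∂P : ℝ≥0∞) : EReal) := by
  have hmax : ∀ {a b : ℝ}, 0 ≤ b →
      ENNReal.ofReal (a - b) + ENNReal.ofReal b = ENNReal.ofReal (max a b) := by
    intro a b hb
    rcases le_total a b with h | h
    · rw [ENNReal.ofReal_of_nonpos (sub_nonpos.2 h), zero_add, max_eq_right h]
    · rw [← ENNReal.ofReal_add (sub_nonneg.2 h) hb, sub_add_cancel, max_eq_left h]
  refine coe_sub_coe_eq_of_add_eq_add hfin (ne_top_of_le_ne_top hfin ?_) ?_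
  · exact lintegral_mono_ae (hB0.mono fun ω h => ENNReal.ofReal_le_ofReal (sub_le_self _ h))
  · rw [← lintegral_add_right _ hB.ennreal_ofReal, ← lintegral_add_left hA.ennreal_ofReal]
    refine lintegral_congr_ae ?_
    filter_upwards [hA0, hB0] with ω ha hb
    rw [neg_sub, add_comm (ENNReal.ofReal (A ω)), hmax ha, hmax hb, max_comm]

lemma lintegral_ofReal_tsum {a : ℕ → Ω → ℝ} (ha : ∀ n, Measurable (a n))
    (ha0 : ∀ n, 0 ≤ᵐ[P] a n) (hfs : ∀ᵐ ω ∂P, Summable fun n => a n ω) :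
    ∫⁻ ω, ENNReal.ofReal (∑' n, a n ω) ∂P = ∑' n, ∫⁻ ω, ENNReal.ofReal (a n ω) ∂P := by
  rw [← lintegral_tsum fun n => (ha n).ennreal_ofReal.aemeasurable]
  refine lintegral_congr_ae ?_
  filter_upwards [ae_all_iff.2 ha0, hfs] with ω h0 hs
  exact ENNReal.ofReal_tsum_of_nonneg h0 hs

lemma expectation_tsum_sub {a b : ℕ → Ω → ℝ} (ha : ∀ n, Measurable (a n))
    (hb : ∀ n, Measurable (b n)) (ha0 : ∀ n, 0 ≤ᵐ[P] a n) (hb0 : ∀ n, 0 ≤ᵐ[P] b n)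
    (has : ∀ᵐ ω ∂P, Summable fun n => a n ω) (hbs : ∀ᵐ ω ∂P, Summable fun n => b n ω)
    (hfin : ∑' n, ∫⁻ ω, ENNReal.ofReal (a n ω) ∂P ≠ ∞) :
    expectation P (fun ω => ∑' n, (a n ω - b n ω))
      = ((∑' n, ∫⁻ ω, ENNReal.ofReal (a n ω) ∂P : ℝ≥0∞) : EReal)
        - ((∑' n, ∫⁻ ω, ENNReal.ofReal (b n ω) ∂P : ℝ≥0∞) : EReal) := by
  have hsub : (fun ω => ∑' n, (a n ω - b n ω)) =ᵐ[P]
      fun ω => (∑' n, a n ω) - ∑' n, b n ω := by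
    filter_upwards [has, hbs] with ω h h'
    exact h.tsum_sub h'
  rw [← lintegral_ofReal_tsum ha ha0 has] at hfin ⊢
  rw [← lintegral_ofReal_tsum hb hb0 hbs, expectation_congr_ae hsub]
  refine expectation_sub (.tsum ha) (.tsum hb) ?_ ?_ hfin
  · exact (ae_all_iff.2 ha0).mono fun ω h => tsum_nonneg h
  · exact (ae_all_iff.2 hb0).mono fun ω h => tsum_nonneg h

end Expectation

/-! ### Markov chains -/

section MarkovChain

variable {X Y : Type*} [MeasurableSpace X] [MeasurableSpace Y]

/-- The transition kernel `κ` as a kernel from histories up to time `n`; it sees only the last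
state. -/
def ofHistory (κ : Kernel X X) (n : ℕ) : Kernel ((i : Finset.Iic n) → X) X :=
  κ.comap (fun h => h ⟨n, Finset.mem_Iic.2 le_rfl⟩) (measurable_pi_apply _)

instance (κ : Kernel X X) [IsMarkovKernel κ] (n : ℕ) : IsMarkovKernel (ofHistory κ n) :=
  inferInstanceAs (IsMarkovKernel (κ.comap _ _))

/-- Law of the (time-inhomogeneous) Markov chain with transition kernels `κ n : X_n → X_{n+1}`
that starts at `x`. -/
def markovLaw (κ : ℕ → Kernel X X) [∀ n, IsMarkovKernel (κ n)] (x : X) : Measure (ℕ → X) :=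
  Kernel.traj (X := fun _ => X) (fun n => ofHistory (κ n) n) 0 fun _ => x

variable {κ : ℕ → Kernel X X} [∀ n, IsMarkovKernel (κ n)] {κ' : ℕ → Kernel Y Y}
  [∀ n, IsMarkovKernel (κ' n)] {x : X}

instance : IsProbabilityMeasure (markovLaw κ x) :=
  inferInstanceAs (IsProbabilityMeasure (Kernel.traj _ _ _))

lemma map_frestrictLe_zero_markovLaw :
    (markovLaw κ x).map (Preorder.frestrictLe 0) = Measure.dirac fun _ => x := by
  rw [markovLaw, Kernel.traj_map_frestrictLe_apply, Kernel.partialTraj_self, Kernel.id_apply]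

lemma ae_zero_markovLaw [MeasurableSingletonClass X] : ∀ᵐ ω ∂markovLaw κ x, ω 0 = x := by
  have hm : Measurable fun h : (i : Finset.Iic 0) → X => h ⟨0, Finset.mem_Iic.2 le_rfl⟩ :=
    measurable_pi_apply _
  have h : ∀ᵐ h ∂(markovLaw κ x).map (Preorder.frestrictLe 0),
      h ⟨0, Finset.mem_Iic.2 le_rfl⟩ = x := by
    rw [map_frestrictLe_zero_markovLaw]
    exact (ae_dirac_iff (hm (measurableSet_singleton x))).2 rfl
  exact ae_of_ae_map (by fun_prop) h

lemma map_frestrictLe_succ_markovLaw (n : ℕ) :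
    (markovLaw κ x).map (fun ω => (Preorder.frestrictLe n ω, ω (n + 1)))
      = (markovLaw κ x).map (Preorder.frestrictLe n) ⊗ₘ ofHistory (κ n) n := by
  rw [markovLaw, Kernel.traj_map_frestrictLe_apply,
    Kernel.partialTraj_compProd_eq_map_traj (Nat.zero_le n)]

lemma lintegral_history_markovLaw (n : ℕ) {H : ((i : Finset.Iic n) → X) × X → ℝ≥0∞}
    (hH : Measurable H) :
    ∫⁻ ω, H (Preorder.frestrictLe n ω, ω (n + 1)) ∂markovLaw κ x
      = ∫⁻ ω, ∫⁻ y, H (Preorder.frestrictLe n ω, y) ∂κ n (ω n) ∂markovLaw κ x := by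
  calc ∫⁻ ω, H (Preorder.frestrictLe n ω, ω (n + 1)) ∂markovLaw κ x
      = ∫⁻ q, H q ∂(markovLaw κ x).map fun ω => (Preorder.frestrictLe n ω, ω (n + 1)) :=
        (lintegral_map hH (by fun_prop)).symm
    _ = _ := by
        rw [map_frestrictLe_succ_markovLaw, Measure.lintegral_compProd hH,
          lintegral_map hH.lintegral_kernel_prod_right' (by fun_prop)]
        rfl

lemma lintegral_markovLaw_succ (n : ℕ) {H : X × X → ℝ≥0∞} (hH : Measurable H) :
    ∫⁻ ω, H (ω n, ω (n + 1)) ∂markovLaw κ x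
      = ∫⁻ ω, ∫⁻ y, H (ω n, y) ∂κ n (ω n) ∂markovLaw κ x :=
  lintegral_history_markovLaw (H := fun q => H (q.1 ⟨n, Finset.mem_Iic.2 le_rfl⟩, q.2)) n
    (by fun_prop)

lemma ae_markovLaw_succ {R : ℕ → Set (X × X)} (hR : ∀ n, MeasurableSet (R n))
    (h : ∀ n a, ∀ᵐ b ∂κ n a, (a, b) ∈ R n) :
    ∀ᵐ ω ∂markovLaw κ x, ∀ n, (ω n, ω (n + 1)) ∈ R n := by
  refine ae_all_iff.2 fun n => ?_
  have hm : Measurable ((R n)ᶜ.indicator (1 : X × X → ℝ≥0∞)) :=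
    measurable_one.indicator (hR n).compl
  have hzero : ∫⁻ ω, (R n)ᶜ.indicator 1 (ω n, ω (n + 1)) ∂markovLaw κ x = 0 := by
    rw [lintegral_markovLaw_succ n hm]
    refine (lintegral_congr fun ω => ?_).trans lintegral_zero
    refine (lintegral_congr_ae ((h n (ω n)).mono fun b hb => ?_)).trans lintegral_zero
    exact indicator_of_notMem (not_not.2 hb) _
  filter_upwards [(lintegral_eq_zero_iff (hm.comp (by fun_prop))).1 hzero] with ω hω
  simpa using hω

lemma measure_ext_of_map_frestrictLe {μ ν : Measure (ℕ → X)} [IsFiniteMeasure μ]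
    [IsFiniteMeasure ν]
    (h : ∀ n, μ.map (Preorder.frestrictLe n) = ν.map (Preorder.frestrictLe n)) : μ = ν := by
  have hproj : IsProjectiveMeasureFamily fun I : Finset ℕ => ν.map I.restrict := by
    intro I J hJI
    exact (Measure.map_map (Finset.measurable_restrict₂ hJI) (Finset.measurable_restrict I)).symm
  exact ((isProjectiveLimit_nat_iff hproj μ).2 h).unique fun _ => rfl

lemma eq_markovLaw {μ : Measure (ℕ → X)} [IsFiniteMeasure μ]
    (hzero : μ.map (Preorder.frestrictLe 0) = Measure.dirac fun _ => x)
    (hsucc : ∀ n, μ.map (fun ω => (Preorder.frestrictLe n ω, ω (n + 1)))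
      = μ.map (Preorder.frestrictLe n) ⊗ₘ ofHistory (κ n) n) :
    μ = markovLaw κ x := by
  refine measure_ext_of_map_frestrictLe fun n => ?_
  induction n with
  | zero => rw [hzero, map_frestrictLe_zero_markovLaw]
  | succ n ih =>
    let glue : ((i : Finset.Iic n) → X) × X → (i : Finset.Iic (n + 1)) → X := fun q i =>
      if h : (i : ℕ) ≤ n then q.1 ⟨i, Finset.mem_Iic.2 h⟩ else q.2
    have hglue : Measurable glue := by
      refine measurable_pi_lambda _ fun i => ?_
      by_cases h : (i : ℕ) ≤ n
      · simp only [glue, h, dif_pos]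
        fun_prop
      · simp only [glue, h, dif_neg, not_false_eq_true]
        fun_prop
    have hcomp : Preorder.frestrictLe (π := fun _ => X) (n + 1)
        = glue ∘ fun ω => (Preorder.frestrictLe n ω, ω (n + 1)) := by
      funext ω i
      by_cases h : (i : ℕ) ≤ n
      · simp [glue, h]
      · have hi : (i : ℕ) = n + 1 := le_antisymm (Finset.mem_Iic.1 i.2) (not_le.1 h)
        simp [glue, hi]
    rw [hcomp, ← Measure.map_map hglue (by fun_prop), ← Measure.map_map hglue (by fun_prop),
      hsucc, ih, map_frestrictLe_succ_markovLaw]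

lemma map_markovLaw {φ : X → Y} (hφ : Measurable φ)
    (h : ∀ n a, (κ n a).map φ = κ' n (φ a)) :
    (markovLaw κ x).map (fun ω n => φ (ω n)) = markovLaw κ' (φ x) := by
  have hΦ : Measurable fun (ω : ℕ → X) n => φ (ω n) := by fun_prop
  have := Measure.isProbabilityMeasure_map (μ := markovLaw κ x) hΦ.aemeasurable
  have hfr : Measurable fun (h : (i : Finset.Iic (0 : ℕ)) → X) i => φ (h i) := by fun_prop
  refine eq_markovLaw ?_ fun n => Measure.ext_of_lintegral _ fun H hH => ?_
  · rw [Measure.map_map (by fun_prop) hΦ,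
      show Preorder.frestrictLe (π := fun _ : ℕ => Y) 0 ∘ (fun (ω : ℕ → X) n => φ (ω n))
        = (fun h i => φ (h i)) ∘ Preorder.frestrictLe (π := fun _ : ℕ => X) 0 from rfl,
      ← Measure.map_map hfr (by fun_prop), map_frestrictLe_zero_markovLaw,
      Measure.map_dirac' hfr]
  · have hG : Measurable fun ω : ℕ → Y => ∫⁻ y, H (Preorder.frestrictLe n ω, y) ∂κ' n (ω n) :=
      (hH.lintegral_kernel_prod_right' (κ := ofHistory (κ' n) n)).comp
        (Preorder.measurable_frestrictLe (X := fun _ : ℕ => Y) n)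
    rw [Measure.lintegral_compProd hH, lintegral_map hH (by fun_prop),
      lintegral_map (by fun_prop) hΦ, lintegral_map hH.lintegral_kernel_prod_right' (by fun_prop)]
    refine (lintegral_history_markovLaw (H := fun q => H (fun i => φ (q.1 i), φ q.2)) n
      (by fun_prop)).trans ((lintegral_congr fun ω => ?_).trans (lintegral_map hG hΦ).symm)
    rw [← h, lintegral_map (by fun_prop) hφ]
    rfl

end MarkovChain

/-! ### The exponential law -/

section Exponential

variable {r x : ℝ}

lemma restrict_Iic_expMeasure (r x : ℝ) :
    (expMeasure r).restrict (Iic x) = (volume.restrict (Ioc 0 x)).withDensity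
      fun s => ENNReal.ofReal (r * Real.exp (-(r * s))) := by
  change (volume.withDensity (exponentialPDF r)).restrict (Iic x) = _
  rw [restrict_withDensity measurableSet_Iic, ← withDensity_indicator measurableSet_Iic,
    ← withDensity_indicator measurableSet_Ioc]
  refine withDensity_congr_ae ?_
  filter_upwards [compl_mem_ae_iff.2 (measure_singleton (0 : ℝ))] with s hs
  rcases lt_or_gt_of_ne hs with h | h
  · rw [indicator_of_notMem fun h' : s ∈ Ioc 0 x => h.not_gt h'.1]
    exact indicator_apply_eq_zero.2 fun _ => exponentialPDF_of_neg h
  · by_cases hx : s ≤ x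
    · rw [indicator_of_mem (show s ∈ Iic x from hx),
        indicator_of_mem (show s ∈ Ioc 0 x from ⟨h, hx⟩), exponentialPDF_of_nonneg h.le]
    · rw [indicator_of_notMem (show s ∉ Iic x from hx),
        indicator_of_notMem fun h' : s ∈ Ioc 0 x => hx h'.2]

lemma expMeasure_Ioi (hr : 0 < r) (hx : 0 ≤ x) :
    expMeasure r (Ioi x) = ENNReal.ofReal (Real.exp (-(r * x))) := by
  have := isProbabilityMeasure_expMeasure hr
  have hexp : Real.exp (-(r * x)) ≤ 1 := Real.exp_le_one_iff.2 (neg_nonpos.2 (by positivity))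
  rw [← compl_Iic, prob_compl_eq_one_sub measurableSet_Iic, ← ofReal_cdf, cdf_expMeasure_eq hr,
    if_pos hx, ← ENNReal.ofReal_one, ← ENNReal.ofReal_sub _ (by linarith), sub_sub_cancel]

lemma ae_pos_expMeasure (hr : 0 < r) : ∀ᵐ s ∂expMeasure r, 0 < s := by
  have := isProbabilityMeasure_expMeasure hr
  have h : expMeasure r (Iic 0) = 0 := by
    rw [← ofReal_cdf, cdf_expMeasure_eq hr]
    simp
  filter_upwards [compl_mem_ae_iff.2 h] with s hs
  exact not_le.1 hs

lemma laplace_expMeasure {s : ℝ} (hr : 0 < r) (hs : 0 ≤ s) :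
    ∫⁻ u, ENNReal.ofReal (Real.exp (-(s * u))) ∂expMeasure r = ENNReal.ofReal (r / (r + s)) := by
  have hm : ∀ c, Measurable (exponentialPDF c) := fun c =>
    (measurable_exponentialPDFReal c).ennreal_ofReal
  have htilt : ∀ u, exponentialPDF r u * ENNReal.ofReal (Real.exp (-(s * u)))
      = ENNReal.ofReal (r / (r + s)) * exponentialPDF (r + s) u := by
    intro u
    rw [exponentialPDF_eq, exponentialPDF_eq]
    split_ifs with hu
    · rw [← ENNReal.ofReal_mul (by positivity), ← ENNReal.ofReal_mul (by positivity), mul_assoc,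
        ← Real.exp_add, ← mul_assoc, div_mul_cancel₀ _ (by positivity), add_mul, neg_add]
    · simp only [ENNReal.ofReal_zero, zero_mul, mul_zero]
  calc ∫⁻ u, ENNReal.ofReal (Real.exp (-(s * u))) ∂expMeasure r
      = ∫⁻ u, exponentialPDF r u * ENNReal.ofReal (Real.exp (-(s * u))) :=
        lintegral_withDensity_eq_lintegral_mul _ (hm r) (by fun_prop)
    _ = ENNReal.ofReal (r / (r + s)) := by
        simp_rw [htilt]
        rw [lintegral_const_mul _ (hm _), lintegral_exponentialPDF_eq_one (by linarith), mul_one]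

lemma lintegral_min_expMeasure (hr : 0 < r) (hx : 0 ≤ x) :
    ∫⁻ s, ENNReal.ofReal (min s x) ∂expMeasure r
      = ENNReal.ofReal (1 / r - Real.exp (-(r * x)) / r) := by
  have htail : ∀ s ∈ Ioi (0 : ℝ), expMeasure r {u | s < min u x}
      = (Iio x).indicator (fun s => ENNReal.ofReal (Real.exp (-(r * s)))) s := by
    intro s hs
    by_cases hsx : s < x
    · simp only [lt_min_iff, hsx, and_true, indicator_of_mem (show s ∈ Iio x from hsx)]
      exact expMeasure_Ioi hr (le_of_lt hs)
    · simp [hsx]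
  have hdensity := Model.integral_density r.toNNReal x
  rw [withDensity_apply _ .univ, Measure.restrict_univ, Real.coe_toNNReal _ hr.le,
    max_eq_left hx] at hdensity
  rw [lintegral_eq_lintegral_meas_lt _ ((ae_pos_expMeasure hr).mono fun s hs => le_min hs.le hx)
      (by fun_prop), setLIntegral_congr_fun measurableSet_Ioi htail,
    setLIntegral_indicator measurableSet_Iio, inter_comm, Ioi_inter_Iio,
    setLIntegral_congr Ioo_ae_eq_Ioc, ← sub_div, div_eq_inv_mul, ENNReal.ofReal_mul (by positivity),
    ← hdensity, ← lintegral_const_mul _ (by fun_prop)]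
  refine lintegral_congr fun s => ?_
  rw [← ENNReal.ofReal_mul (by positivity), inv_mul_cancel_left₀ hr.ne']

lemma one_div_sub_exp_div_nonneg (hr : 0 < r) (hx : 0 ≤ x) :
    0 ≤ 1 / r - Real.exp (-(r * x)) / r := by
  rw [← sub_div]
  exact div_nonneg (sub_nonneg.2 (Real.exp_le_one_iff.2 (neg_nonpos.2 (by positivity)))) hr.le

lemma lintegral_reward_expMeasure {φ γ : ℝ} (hr : 0 < r) (hx : 0 ≤ x) (hφ : 0 ≤ φ) (hγ : 0 ≤ γ) :
    ∫⁻ s, ENNReal.ofReal (φ * min s x + (Ioi x).indicator (fun _ => γ) s) ∂expMeasure r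
      = ENNReal.ofReal (φ * (1 / r - Real.exp (-(r * x)) / r) + Real.exp (-(r * x)) * γ) := by
  have hmean := one_div_sub_exp_div_nonneg hr hx
  calc ∫⁻ s, ENNReal.ofReal (φ * min s x + (Ioi x).indicator (fun _ => γ) s) ∂expMeasure r
      = ∫⁻ s, (ENNReal.ofReal φ * ENNReal.ofReal (min s x)
          + (Ioi x).indicator (fun _ => ENNReal.ofReal γ) s) ∂expMeasure r := by
        refine lintegral_congr_ae ((ae_pos_expMeasure hr).mono fun s hs => ?_)
        have hrunning : 0 ≤ φ * min s x := mul_nonneg hφ (le_min hs.le hx)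
        simp only [indicator_apply]
        split_ifs
        · rw [ENNReal.ofReal_add hrunning hγ, ENNReal.ofReal_mul hφ]
        · rw [add_zero, add_zero, ENNReal.ofReal_mul hφ]
    _ = ENNReal.ofReal φ * ENNReal.ofReal (1 / r - Real.exp (-(r * x)) / r)
          + ENNReal.ofReal γ * ENNReal.ofReal (Real.exp (-(r * x))) := by
        rw [lintegral_add_left (by fun_prop), lintegral_const_mul _ (by fun_prop),
          lintegral_min_expMeasure hr hx, lintegral_indicator_const measurableSet_Ioi,
          expMeasure_Ioi hr hx]
    _ = _ := by
        rw [← ENNReal.ofReal_mul hφ, ← ENNReal.ofReal_mul hγ,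
          ← ENNReal.ofReal_add (by positivity) (by positivity), mul_comm γ]

end Exponential

variable {K M : ℕ}

/-! ### Jump times and killing at the horizon -/

instance {A B : Type*} [MeasurableSpace A] [MeasurableSpace B] [MeasurableSingletonClass A]
    [MeasurableSingletonClass B] : MeasurableSingletonClass (A ⊕ B) where
  measurableSet_singleton
    | .inl a => by simpa using (measurableSet_singleton a).inl_image (β := B)
    | .inr b => by simpa using (measurableSet_singleton b).inr_image (α := A)

/-- The jump time of a node; it is infinite at the cemetery. -/
def jumpTime : Node K M → EReal := Sum.elim (fun p => (p.1 : EReal)) fun _ => ⊤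

@[simp] lemma jumpTime_inl (p : ℝ × State K M) : jumpTime (.inl p) = p.1 := rfl

@[simp] lemma jumpTime_inr (u : Unit) : jumpTime (.inr u : Node K M) = ⊤ := rfl

@[fun_prop]
lemma measurable_jumpTime : Measurable (jumpTime : Node K M → EReal) :=
  Measurable.sumElim (by fun_prop) measurable_const

open Classical in
/-- Killing at time `T`: nodes with a jump time beyond `T` are sent to the cemetery. -/
def kill (T : ℝ) (x : Node K M) : Node K M := if jumpTime x ≤ T then x else .inr ()

lemma measurable_kill (T : ℝ) : Measurable (kill T : Node K M → Node K M) :=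
  Measurable.ite (measurableSet_le measurable_jumpTime measurable_const) measurable_id
    measurable_const

lemma kill_of_le {T : ℝ} {x : Node K M} (h : jumpTime x ≤ T) : kill T x = x := if_pos h

lemma kill_of_lt {T : ℝ} {x : Node K M} (h : T < jumpTime x) : kill T x = .inr () :=
  if_neg (not_le.2 h)

lemma kill_inl_of_le {T : ℝ} {p : ℝ × State K M} (h : p.1 ≤ T) : kill T (.inl p) = .inl p :=
  kill_of_le (by simpa using h)

lemma kill_inl_of_lt {T : ℝ} {p : ℝ × State K M} (h : T < p.1) : kill T (.inl p) = .inr () :=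
  kill_of_lt (by simpa using h)

lemma kill_inr (T : ℝ) (u : Unit) : kill T (.inr u : Node K M) = .inr () := kill_of_lt (by simp)

lemma measurable_inl_add (t : ℝ) :
    Measurable fun q : ℝ × State K M => (.inl (t + q.1, q.2) : Node K M) :=
  measurable_inl.comp (by fun_prop)

namespace Model

variable (m : Model K M) (α : Policy K M)

lemma nextJump_of_totalRate_eq_zero {p : ℝ × State K M} {a : Action K M}
    (h : m.totalRate p.2.2 = 0) : m.nextJump p a = Measure.dirac (.inr ()) := if_pos h

lemma isProbabilityMeasure_waitingTime {c : Config K M} (h : m.totalRate c ≠ 0) :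
    IsProbabilityMeasure (expMeasure (m.totalRate c)) :=
  isProbabilityMeasure_expMeasure (NNReal.coe_pos.2 (pos_iff_ne_zero.2 h))

lemma lintegral_jumpTime_nextJump {p : ℝ × State K M} {a : Action K M}
    (h : m.totalRate p.2.2 ≠ 0) {H : EReal → ℝ≥0∞} (hH : Measurable H) :
    ∫⁻ y, H (jumpTime y) ∂m.nextJump p a
      = ∫⁻ s, H ((p.1 + s : ℝ) : EReal) ∂expMeasure (m.totalRate p.2.2) := by
  have := m.isProbabilityMeasure_jumpLaw p.2 a h
  rw [nextJump, if_neg h, lintegral_map (by fun_prop) (measurable_inl_add _)]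
  exact measurePreserving_fst.lintegral_comp (f := fun s : ℝ => H ((p.1 + s : ℝ) : EReal))
    (by fun_prop)

lemma ae_nextJump {p : ℝ × State K M} {a : Action K M} {S : Set (Node K M)} (hS : MeasurableSet S)
    (hinr : .inr () ∈ S)
    (hinl : ∀ᵐ z ∂m.jumpLaw p.2 a, ∀ s : ℝ, 0 < s → Sum.inl (p.1 + s, z) ∈ S) :
    ∀ᵐ y ∂m.nextJump p a, y ∈ S := by
  by_cases h : m.totalRate p.2.2 = 0
  · rw [m.nextJump_of_totalRate_eq_zero h]
    exact (ae_dirac_iff hS).2 hinr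
  · have := m.isProbabilityMeasure_waitingTime h
    rw [nextJump, if_neg h, ae_map_iff (p := (· ∈ S)) (measurable_inl_add p.1).aemeasurable hS]
    have hpos := ae_pos_expMeasure (NNReal.coe_pos.2 (pos_iff_ne_zero.2 h))
    filter_upwards [Measure.quasiMeasurePreserving_fst.ae hpos,
      Measure.quasiMeasurePreserving_snd.ae hinl] with q hq hq'
    exact hq' q.1 hq

lemma ae_jumpTime_le_nextJump (p : ℝ × State K M) (a : Action K M) :
    ∀ᵐ y ∂m.nextJump p a, (p.1 : EReal) ≤ jumpTime y := by
  refine m.ae_nextJump (S := {y | (p.1 : EReal) ≤ jumpTime y})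
    (measurableSet_le measurable_const measurable_jumpTime) (by simp) (ae_of_all _ fun z s hs => ?_)
  exact EReal.coe_le_coe_iff.2 (le_add_of_nonneg_right hs.le)

lemma map_kill_nextJump_of_lt {p : ℝ × State K M} {a : Action K M} (hp : m.T < p.1) :
    (m.nextJump p a).map (kill m.T) = Measure.dirac (.inr ()) := by
  have := m.isProbabilityMeasure_nextJump p a
  have hkill : kill m.T =ᵐ[m.nextJump p a] fun _ => .inr () :=
    (m.ae_jumpTime_le_nextJump p a).mono fun y hy =>
      kill_of_lt ((EReal.coe_lt_coe_iff.2 hp).trans_le hy)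
  rw [Measure.map_congr hkill, Measure.map_const, measure_univ, one_smul]

lemma map_kill_nextJump {p : ℝ × State K M} {a : Action K M} (hp : p.1 ≤ m.T) :
    (m.nextJump p a).map (kill m.T) = m.mdpLaw p a := by
  by_cases h : m.totalRate p.2.2 = 0
  · rw [m.nextJump_of_totalRate_eq_zero h, Measure.map_dirac' (measurable_kill _),
      kill_inr, mdpLaw]
    simp [h]
  have hrate : (0 : ℝ) < m.totalRate p.2.2 := NNReal.coe_pos.2 (pos_iff_ne_zero.2 h)
  have := m.isProbabilityMeasure_waitingTime h
  have := m.isProbabilityMeasure_jumpLaw p.2 a h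
  set μ := expMeasure (m.totalRate p.2.2)
  set J := m.jumpLaw p.2 a
  let node : ℝ × State K M → Node K M := fun q => .inl (p.1 + q.1, q.2)
  have hnode : Measurable node := measurable_inl_add _
  have hsplit : μ.prod J = (μ.restrict (Iic (m.T - p.1))).prod J
      + (μ.restrict (Ioi (m.T - p.1))).prod J := by
    rw [← Measure.add_prod, ← compl_Iic, Measure.restrict_add_restrict_compl measurableSet_Iic]
  have hbefore : ((μ.restrict (Iic (m.T - p.1))).prod J).map (kill m.T ∘ node)
      = ((μ.restrict (Iic (m.T - p.1))).prod J).map node := by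
    refine Measure.map_congr ?_
    filter_upwards [Measure.quasiMeasurePreserving_fst.ae (ae_restrict_mem measurableSet_Iic)]
      with q hq
    exact kill_inl_of_le (le_sub_iff_add_le'.1 hq)
  have hafter : ((μ.restrict (Ioi (m.T - p.1))).prod J).map (kill m.T ∘ node)
      = μ (Ioi (m.T - p.1)) • Measure.dirac (.inr ()) := by
    have hconst : kill m.T ∘ node =ᵐ[(μ.restrict (Ioi (m.T - p.1))).prod J] fun _ => .inr () := by
      filter_upwards [Measure.quasiMeasurePreserving_fst.ae (ae_restrict_mem measurableSet_Ioi)]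
        with q hq
      exact kill_inl_of_lt (sub_lt_iff_lt_add'.1 hq)
    rw [Measure.map_congr hconst, Measure.map_const, ← univ_prod_univ, Measure.prod_prod,
      Measure.restrict_apply_univ, measure_univ (μ := J), mul_one]
  rw [nextJump, if_neg h, Measure.map_map (measurable_kill _) hnode, hsplit,
    Measure.map_add _ _ ((measurable_kill _).comp hnode), hbefore, hafter,
    restrict_Iic_expMeasure, expMeasure_Ioi hrate (sub_nonneg.2 hp), mdpLaw,
    max_eq_left (sub_nonneg.2 hp)]

/-- The transition kernels of the jump chain `(T_n, Z_n)` under the policy `α`. -/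
def jumpKernel (n : ℕ) : Kernel (Node K M) (Node K M) :=
  α.step m.nextJump m.measurable_nextJump n

/-- The transition kernels of the decision process under the policy `α`. -/
def mdpKernel (n : ℕ) : Kernel (Node K M) (Node K M) :=
  α.step m.mdpLaw m.measurable_mdpLaw n

instance (n : ℕ) : IsMarkovKernel (m.jumpKernel α n) :=
  α.isMarkovKernel_step _ _ m.isProbabilityMeasure_nextJump n

instance (n : ℕ) : IsMarkovKernel (m.mdpKernel α n) :=
  α.isMarkovKernel_step _ _ m.isProbabilityMeasure_mdpLaw n

lemma law_eq_markovLaw (t : ℝ) (z : State K M) :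
    m.law α t z = markovLaw (m.jumpKernel α) (.inl (t, z)) := rfl

instance (t : ℝ) (z : State K M) : IsProbabilityMeasure (m.law α t z) :=
  inferInstanceAs (IsProbabilityMeasure (markovLaw (m.jumpKernel α) _))

lemma mdpChain_eq_markovLaw (t : ℝ) (z : State K M) :
    m.mdpChain α t z = markovLaw (m.mdpKernel α) (.inl (t, z)) := rfl

lemma map_kill_jumpKernel (n : ℕ) (x : Node K M) :
    (m.jumpKernel α n x).map (kill m.T) = m.mdpKernel α n (kill m.T x) := by
  rcases x with p | u
  · rcases le_or_gt p.1 m.T with hp | hp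
    · rw [kill_inl_of_le hp]
      exact m.map_kill_nextJump hp
    · rw [kill_inl_of_lt hp]
      exact m.map_kill_nextJump_of_lt hp
  · rw [kill_inr]
    change (Measure.dirac (.inr ())).map (kill m.T) = Measure.dirac (.inr ())
    rw [Measure.map_dirac' (measurable_kill _), kill_inr]

lemma mdpChain_eq_map_kill_law {t : ℝ} (ht : t ≤ m.T) (z : State K M) :
    m.mdpChain α t z = (m.law α t z).map fun ω n => kill m.T (ω n) := by
  rw [law_eq_markovLaw, map_markovLaw (measurable_kill _) (m.map_kill_jumpKernel α),
    kill_inl_of_le ht, mdpChain_eq_markovLaw]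

end Model

/-! ### Trajectories of the jump chain -/

lemma jumpTime_ne_bot (x : Node K M) : jumpTime x ≠ ⊥ := by
  rcases x with _ | _ <;> simp

/-- The time `τ ∧ T`, as a real number; `τ` may be infinite. -/
def cutoff (T : ℝ) (τ : EReal) : ℝ := (min τ T).toReal

section Cutoff

variable {T : ℝ} {τ : EReal}

@[fun_prop]
lemma measurable_cutoff (T : ℝ) : Measurable (cutoff T) := by
  unfold cutoff
  fun_prop

lemma coe_cutoff (hτ : τ ≠ ⊥) : (cutoff T τ : EReal) = min τ T :=
  EReal.coe_toReal (ne_top_of_le_ne_top (EReal.coe_ne_top T) (min_le_right _ _))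
    fun h => by rcases min_eq_bot.1 h with h | h <;> simp_all

lemma cutoff_coe (T s : ℝ) : cutoff T s = min s T :=
  EReal.coe_injective <|
    (coe_cutoff (EReal.coe_ne_bot s)).trans EReal.coe_strictMono.monotone.map_min.symm

lemma cutoff_of_le (h : T ≤ τ) : cutoff T τ = T := by
  rw [cutoff, min_eq_right h, EReal.toReal_coe]

lemma cutoff_mono {τ' : EReal} (hτ : τ ≠ ⊥) (h : τ ≤ τ') : cutoff T τ ≤ cutoff T τ' := by
  rw [← EReal.coe_le_coe_iff, coe_cutoff hτ, coe_cutoff (ne_bot_of_le_ne_bot hτ h)]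
  exact min_le_min_right _ h

end Cutoff

lemma arrivals_eq_of_lt {ω : ℕ → Node K M} (hω : Monotone fun n => jumpTime (ω n)) {s : ℝ} {n : ℕ}
    (hle : jumpTime (ω n) ≤ s) (hlt : s < jumpTime (ω (n + 1))) : arrivals ω s = n := by
  have hset : {k | ∃ p, ω k = Sum.inl p ∧ p.1 ≤ s} = Iic n := by
    ext k
    have hiff : (∃ p, ω k = Sum.inl p ∧ p.1 ≤ s) ↔ jumpTime (ω k) ≤ s := by
      rcases ω k with _ | _ <;> simp
    rw [mem_ofPred_eq, hiff, mem_Iic]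
    refine ⟨fun hk => ?_, fun hk => (hω hk).trans hle⟩
    by_contra! hnk
    exact (hlt.trans_le (hω (Nat.succ_le_of_lt hnk))).not_ge hk
  rw [arrivals, hset, csSup_Iic]

lemma arrivals_eq_of_mem_Ioo {ω : ℕ → Node K M} (hω : Monotone fun n => jumpTime (ω n)) {T s : ℝ}
    {n : ℕ} (hs : s ∈ Ioo (cutoff T (jumpTime (ω n))) (cutoff T (jumpTime (ω (n + 1))))) :
    arrivals ω s = n := by
  have hlt : (s : EReal) < min (jumpTime (ω (n + 1))) T := by
    rw [← coe_cutoff (jumpTime_ne_bot _)]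
    exact mod_cast hs.2
  have hgt : min (jumpTime (ω n)) T < s := by
    rw [← coe_cutoff (jumpTime_ne_bot _)]
    exact mod_cast hs.1
  have hle := (min_lt_iff.1 hgt).resolve_right (lt_min_iff.1 hlt).2.not_gt
  exact arrivals_eq_of_lt hω hle.le (lt_min_iff.1 hlt).1

/-- A trajectory of the jump chain that starts at time `t`, with ordered jump times of which
finitely many are at most `T`. -/
structure Regular (ω : ℕ → Node K M) (t T : ℝ) : Prop where
  zero : jumpTime (ω 0) = t
  mono : Monotone fun n => jumpTime (ω n)
  finite : {n | jumpTime (ω n) ≤ T}.Finite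

namespace Regular

variable {ω : ℕ → Node K M} {t T : ℝ}

lemma arrivals_spec (h : Regular ω t T) (ht : t ≤ T) :
    jumpTime (ω (arrivals ω T)) ≤ T ∧ T < jumpTime (ω (arrivals ω T + 1)) := by
  obtain ⟨N, hle, hlt⟩ : ∃ N, jumpTime (ω N) ≤ T ∧ T < jumpTime (ω (N + 1)) := by
    by_contra! hall
    have hle : ∀ n, jumpTime (ω n) ≤ T := Nat.rec (h.zero.trans_le (mod_cast ht)) hall
    exact infinite_univ (h.finite.subset fun n _ => hle n)
  rw [arrivals_eq_of_lt h.mono hle hlt]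
  exact ⟨hle, hlt⟩

lemma arrivals_eq_iff (h : Regular ω t T) (ht : t ≤ T) {n : ℕ} :
    arrivals ω T = n ↔ jumpTime (ω n) ≤ T ∧ T < jumpTime (ω (n + 1)) := by
  refine ⟨?_, fun hn => arrivals_eq_of_lt h.mono hn.1 hn.2⟩
  rintro rfl
  exact h.arrivals_spec ht

lemma hasSum_integral_arrivals (h : Regular ω t T) (ht : t ≤ T) (c : ℕ → ℝ) :
    HasSum (fun n => c n * (cutoff T (jumpTime (ω (n + 1))) - cutoff T (jumpTime (ω n))))
      (∫ s in t..T, c (arrivals ω s)) := by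
  set N := arrivals ω T
  set τ : ℕ → ℝ := fun n => cutoff T (jumpTime (ω n))
  have hτ_mono : ∀ n, τ n ≤ τ (n + 1) := fun n =>
    cutoff_mono (jumpTime_ne_bot _) (h.mono n.le_succ)
  have hτ_zero : τ 0 = t := by simp only [τ, h.zero, cutoff_coe, min_eq_left ht]
  have hτ_last : ∀ n, N < n → τ n = T := fun n hn =>
    cutoff_of_le ((h.arrivals_spec ht).2.le.trans (h.mono hn))
  have hconst : ∀ n, EqOn (fun s => c (arrivals ω s)) (fun _ => c n) (Ioo (τ n) (τ (n + 1))) :=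
    fun n s hs => congrArg c (arrivals_eq_of_mem_Ioo h.mono hs)
  have hint : ∀ n, IntervalIntegrable (fun s => c (arrivals ω s)) volume (τ n) (τ (n + 1)) :=
    fun n => (intervalIntegrable_const (c := c n)).congr_uIoo
      (by rw [uIoo_of_le (hτ_mono n)]; exact (hconst n).symm)
  have hval : ∫ s in t..T, c (arrivals ω s)
      = ∑ n ∈ Finset.range (N + 1), c n * (τ (n + 1) - τ n) := by
    rw [← hτ_zero, ← hτ_last (N + 1) N.lt_succ_self,
      ← intervalIntegral.sum_integral_adjacent_intervals fun n _ => hint n]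
    refine Finset.sum_congr rfl fun n _ => ?_
    rw [intervalIntegral.integral_congr_Ioo_of_le (hτ_mono n) (hconst n),
      intervalIntegral.integral_const, smul_eq_mul, mul_comm]
  rw [hval]
  refine hasSum_sum_of_ne_finset_zero (f := fun n => c n * (τ (n + 1) - τ n)) fun n hn => ?_
  have hn : N < n := Nat.lt_of_succ_le (by simpa using hn)
  rw [hτ_last n hn, hτ_last (n + 1) (hn.trans n.lt_succ_self), sub_self, mul_zero]

open Classical in
lemma hasSum_arrivals (h : Regular ω t T) (ht : t ≤ T) (c : ℕ → ℝ) :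
    HasSum (fun n => if jumpTime (ω n) ≤ T ∧ T < jumpTime (ω (n + 1)) then c n else 0)
      (c (arrivals ω T)) := by
  convert hasSum_ite_eq (arrivals ω T) (c (arrivals ω T)) using 2 with n
  simp only [← h.arrivals_eq_iff ht, eq_comm (b := n)]
  aesop

end Regular

/-! ### Rewards per period -/

lemma measurable_afterDecision (a : Action K M) : Measurable (afterDecision a : State K M → _) :=
  measurable_fst.prodMk ((Measurable.of_discrete (f := fun c : Config K M =>
    ({ c with ask := c.ask.place a.ask, bid := c.bid.place a.bid } : Config K M))).comp
      measurable_snd)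

namespace Policy

variable (α : Policy K M)

lemma measurable_comp_rule {β : Type*} [MeasurableSpace β] (n : ℕ)
    {F : Action K M → ℝ × State K M → β} (hF : ∀ a, Measurable (F a)) :
    Measurable fun p => F (α.rule n p) p := by
  have h : Measurable fun q : (ℝ × State K M) × Action K M => F q.2 q.1 :=
    measurable_from_prod_countable_left hF
  exact h.comp (measurable_id.prodMk (α.measurable n))

/-- The control and the state held during the `n`-th period, which starts at the given node. The
value at the cemetery is the one of `current` there. -/
def held (n : ℕ) : Node K M → Action K M × State K M :=
  Sum.elim (fun p => (α.rule n p, afterDecision (α.rule n p) p.2)) fun _ => default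

lemma current_eq_held (ω : ℕ → Node K M) (s : ℝ) :
    current α ω s = α.held (arrivals ω s) (ω (arrivals ω s)) := by
  unfold current
  cases ω (arrivals ω s) <;> rfl

lemma measurable_comp_held (n : ℕ) {F : Action K M → State K M → ℝ} (hF : ∀ a, Measurable (F a)) :
    Measurable fun x => F (α.held n x).1 (α.held n x).2 :=
  measurable_fun_sum (α.measurable_comp_rule n (F := fun a p => F a (afterDecision a p.2)) fun a =>
    (hF a).comp ((measurable_afterDecision a).comp measurable_snd))
    (measurable_const (a := F (default : Action K M × State K M).1 default))

end Policy

namespace Model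

variable (m : Model K M) (α : Policy K M)

open Classical in
/-- The reward of the continuous-time problem collected in the `n`-th period, between the nodes `x`
and `y`; the terminal reward is attributed to the period that contains the horizon. -/
def periodReward (n : ℕ) (x y : Node K M) : ℝ :=
  m.f (α.held n x).1 (α.held n x).2 * (cutoff m.T (jumpTime y) - cutoff m.T (jumpTime x))
    + if jumpTime x ≤ m.T ∧ m.T < jumpTime y then m.g (α.held n x).2 else 0

/-- The reward of the decision process collected in the `n`-th period, which starts at `x`. -/
def nodeReward (n : ℕ) : Node K M → ℝ :=
  Sum.elim (fun p => m.reward p.1 p.2 (α.rule n p)) fun _ => 0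

lemma stepReward_eq_nodeReward (ω : ℕ → Node K M) (n : ℕ) :
    m.stepReward α ω n = m.nodeReward α n (ω n) :=
  rfl

lemma nodeReward_of_lt {n : ℕ} {x : Node K M} (h : m.T < jumpTime x) : m.nodeReward α n x = 0 := by
  rcases x with p | _
  · exact if_neg (by simpa using h)
  · rfl

lemma nodeReward_kill (n : ℕ) (x : Node K M) :
    m.nodeReward α n (kill m.T x) = m.nodeReward α n x := by
  rcases le_or_gt (jumpTime x) m.T with h | h
  · rw [kill_of_le h]
  · rw [kill_of_lt h, m.nodeReward_of_lt α h]
    rfl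

lemma measurable_periodReward (hf : ∀ a, Measurable (m.f a)) (hg : Measurable m.g) (n : ℕ) :
    Measurable fun q : Node K M × Node K M => m.periodReward α n q.1 q.2 := by
  have hrun : Measurable fun q : Node K M × Node K M =>
      m.f (α.held n q.1).1 (α.held n q.1).2 := (α.measurable_comp_held n hf).comp measurable_fst
  have hterm : Measurable fun q : Node K M × Node K M => m.g (α.held n q.1).2 :=
    (α.measurable_comp_held n (F := fun _ => m.g) fun _ => hg).comp measurable_fst
  have hx : Measurable fun q : Node K M × Node K M => jumpTime q.1 := by fun_prop
  have hy : Measurable fun q : Node K M × Node K M => jumpTime q.2 := by fun_prop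
  have hlast : MeasurableSet {q : Node K M × Node K M | jumpTime q.1 ≤ m.T ∧ m.T < jumpTime q.2} :=
    (measurableSet_le hx measurable_const).inter (measurableSet_lt measurable_const hy)
  exact (hrun.mul (by fun_prop)).add (hterm.ite hlast measurable_const)

lemma measurable_periodReward_chain (hf : ∀ a, Measurable (m.f a)) (hg : Measurable m.g) (n : ℕ) :
    Measurable fun ω : ℕ → Node K M => m.periodReward α n (ω n) (ω (n + 1)) :=
  (m.measurable_periodReward α hf hg n).comp
    (g := fun q => m.periodReward α n q.1 q.2) (f := fun ω : ℕ → Node K M => (ω n, ω (n + 1)))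
    (by fun_prop)

lemma measurable_nodeReward (hf : ∀ a, Measurable (m.f a)) (hg : Measurable m.g) (n : ℕ) :
    Measurable (m.nodeReward α n) := by
  refine Measurable.sumElim (α.measurable_comp_rule n (F := fun a p => m.reward p.1 p.2 a)
    fun a => ?_) measurable_const
  have hrate : Measurable fun p : ℝ × State K M => (m.totalRate p.2.2 : ℝ) :=
    (Measurable.of_discrete (f := fun c => (m.totalRate c : ℝ))).comp (by fun_prop)
  have hafter : Measurable fun p : ℝ × State K M => afterDecision a p.2 :=
    (measurable_afterDecision a).comp measurable_snd
  refine Measurable.ite (measurableSet_le measurable_fst measurable_const) ?_ measurable_const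
  refine (((hf a).comp hafter).mul (Measurable.ite (hrate (measurableSet_singleton 0)) ?_ ?_)).add
    (Measurable.mul ?_ (hg.comp hafter)) <;> fun_prop

lemma lintegral_periodReward_inl (hf : ∀ a z, 0 ≤ m.f a z) (hg : ∀ z, 0 ≤ m.g z) (n : ℕ)
    {p : ℝ × State K M} (hp : p.1 ≤ m.T) :
    ∫⁻ y, ENNReal.ofReal (m.periodReward α n (.inl p) y) ∂m.nextJump p (α.rule n p)
      = ENNReal.ofReal (m.reward p.1 p.2 (α.rule n p)) := by
  classical
  set a := α.rule n p
  set φ := m.f a (afterDecision a p.2)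
  set γ := m.g (afterDecision a p.2)
  let H : EReal → ℝ≥0∞ := fun τ =>
    ENNReal.ofReal (φ * (cutoff m.T τ - p.1) + if m.T < τ then γ else 0)
  have hH : Measurable H := by
    refine ((by fun_prop : Measurable fun τ => φ * (cutoff m.T τ - p.1)).add ?_).ennreal_ofReal
    exact Measurable.ite (measurableSet_lt measurable_const measurable_id) measurable_const
      measurable_const
  have hperiod : ∀ y, ENNReal.ofReal (m.periodReward α n (.inl p) y) = H (jumpTime y) := by
    intro y
    have hp' : (p.1 : EReal) ≤ m.T := mod_cast hp
    simp only [periodReward, jumpTime_inl, cutoff_coe, min_eq_left hp, hp', true_and, H]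
    rfl
  simp only [hperiod, reward, if_pos hp]
  by_cases hrate : m.totalRate p.2.2 = 0
  · rw [m.nextJump_of_totalRate_eq_zero hrate, lintegral_dirac]
    simp [H, hrate, cutoff_of_le, φ, γ]
  · have hpos : (0 : ℝ) < m.totalRate p.2.2 := NNReal.coe_pos.2 (pos_iff_ne_zero.2 hrate)
    rw [m.lintegral_jumpTime_nextJump hrate hH, if_neg hpos.ne',
      ← lintegral_reward_expMeasure hpos (sub_nonneg.2 hp) (hf _ _) (hg _)]
    refine lintegral_congr fun s => ?_
    have hmin : min (p.1 + s) m.T - p.1 = min s (m.T - p.1) := by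
      rw [← min_sub_sub_right, add_sub_cancel_left]
    simp only [H, cutoff_coe, hmin, indicator_apply, mem_Ioi, EReal.coe_lt_coe_iff,
      sub_lt_iff_lt_add']
    rfl

lemma lintegral_periodReward (hf : ∀ a z, 0 ≤ m.f a z) (hg : ∀ z, 0 ≤ m.g z)
    (n : ℕ) (x : Node K M) :
    ∫⁻ y, ENNReal.ofReal (m.periodReward α n x y) ∂m.jumpKernel α n x
      = ENNReal.ofReal (m.nodeReward α n x) := by
  rcases x with p | u
  · rcases le_or_gt p.1 m.T with hp | hp
    · exact m.lintegral_periodReward_inl α hf hg n hp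
    · rw [m.nodeReward_of_lt α (by simpa using hp), ENNReal.ofReal_zero]
      have hp' : (m.T : EReal) < p.1 := mod_cast hp
      refine (lintegral_congr_ae ?_).trans lintegral_zero
      refine (m.ae_jumpTime_le_nextJump p (α.rule n p)).mono fun y hy => ?_
      simp [periodReward, cutoff_of_le hp'.le, cutoff_of_le (hp'.le.trans hy), hp'.not_ge]
  · refine (lintegral_dirac (Sum.inr u : Node K M) _).trans ?_
    simp [periodReward, nodeReward]

lemma periodReward_nonneg (hf : ∀ a z, 0 ≤ m.f a z) (hg : ∀ z, 0 ≤ m.g z) {n : ℕ} {x y : Node K M}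
    (h : jumpTime x ≤ jumpTime y) : 0 ≤ m.periodReward α n x y := by
  refine add_nonneg (mul_nonneg (hf _ _) (sub_nonneg.2 (cutoff_mono (jumpTime_ne_bot x) h))) ?_
  split_ifs
  exacts [hg _, le_rfl]

lemma hasSum_periodReward {ω : ℕ → Node K M} {t : ℝ} (h : Regular ω t m.T) (ht : t ≤ m.T) :
    HasSum (fun n => m.periodReward α n (ω n) (ω (n + 1)))
      ((∫ s in t..m.T, m.f (current α ω s).1 (current α ω s).2) + m.g (current α ω m.T).2) := by
  simp only [α.current_eq_held]
  exact (h.hasSum_integral_arrivals ht fun n => m.f (α.held n (ω n)).1 (α.held n (ω n)).2).add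
    (h.hasSum_arrivals ht fun n => m.g (α.held n (ω n)).2)

lemma summable_nodeReward {ω : ℕ → Node K M} {t : ℝ} (h : Regular ω t m.T) :
    Summable fun n => m.nodeReward α n (ω n) :=
  summable_of_hasFiniteSupport (h.finite.subset fun n hn => by
    by_contra! hlt
    exact hn (m.nodeReward_of_lt α (not_le.1 hlt)))

/-! ### Splitting the rewards into positive and negative parts -/

/-- The model with the positive parts of the rewards. -/
def positivePart : Model K M := { m with f := fun a z => (m.f a z)⁺, g := fun z => (m.g z)⁺ }

/-- The model with the negative parts of the rewards. -/
def negativePart : Model K M := { m with f := fun a z => (m.f a z)⁻, g := fun z => (m.g z)⁻ }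

lemma periodReward_eq_sub (n : ℕ) (x y : Node K M) :
    m.periodReward α n x y
      = m.positivePart.periodReward α n x y - m.negativePart.periodReward α n x y := by
  set Δ := cutoff m.T (jumpTime y) - cutoff m.T (jumpTime x)
  have hf := posPart_sub_negPart (m.f (α.held n x).1 (α.held n x).2)
  have hg := posPart_sub_negPart (m.g (α.held n x).2)
  have hperiod : ∃ ε : ℝ, ∀ m' : Model K M, m'.T = m.T → m'.periodReward α n x y
      = m'.f (α.held n x).1 (α.held n x).2 * Δ + ε * m'.g (α.held n x).2 := by
    by_cases hlast : jumpTime x ≤ m.T ∧ m.T < jumpTime y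
    · refine ⟨1, fun m' hT => ?_⟩
      rw [periodReward, hT, if_pos hlast, one_mul]
    · refine ⟨0, fun m' hT => ?_⟩
      rw [periodReward, hT, if_neg hlast, zero_mul]
  obtain ⟨ε, hε⟩ := hperiod
  rw [hε m rfl, hε m.positivePart rfl, hε m.negativePart rfl]
  simp only [positivePart, negativePart]
  linear_combination -Δ * hf - ε * hg

lemma nodeReward_eq_sub (n : ℕ) (x : Node K M) :
    m.nodeReward α n x = m.positivePart.nodeReward α n x - m.negativePart.nodeReward α n x := by
  rcases x with p | _
  · set a := α.rule n p
    set δ : ℝ := if (m.totalRate p.2.2 : ℝ) = 0 then m.T - p.1 else 1 / m.totalRate p.2.2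
      - Real.exp (-(m.totalRate p.2.2 * (m.T - p.1))) / m.totalRate p.2.2
    have hf := posPart_sub_negPart (m.f a (afterDecision a p.2))
    have hg := posPart_sub_negPart (m.g (afterDecision a p.2))
    by_cases hp : p.1 ≤ m.T
    · have hreward : ∀ m' : Model K M, m'.T = m.T → m'.totalRate = m.totalRate →
          m'.reward p.1 p.2 a = m'.f a (afterDecision a p.2) * δ
            + Real.exp (-(m.totalRate p.2.2 * (m.T - p.1))) * m'.g (afterDecision a p.2) := by
        intro m' hT hrate
        simp only [reward, hT, hrate, if_pos hp, δ]
      change m.reward p.1 p.2 a = m.positivePart.reward p.1 p.2 a - m.negativePart.reward p.1 p.2 a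
      rw [hreward m rfl rfl, hreward m.positivePart rfl rfl, hreward m.negativePart rfl rfl]
      simp only [positivePart, negativePart]
      linear_combination -δ * hf - Real.exp (-(m.totalRate p.2.2 * (m.T - p.1))) * hg
    · have hlt : (m.T : EReal) < jumpTime (.inl p : Node K M) := by simpa using hp
      rw [m.nodeReward_of_lt α hlt, m.positivePart.nodeReward_of_lt α hlt,
        m.negativePart.nodeReward_of_lt α hlt, sub_zero]
  · exact (sub_zero 0).symm

end Model

/-! ### Comparison of the two problems -/

namespace Model

variable (m : Model K M) (α : Policy K M) {t : ℝ} {z : State K M}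

/-- Non-explosion: under every policy, almost surely finitely many orders arrive up to the
horizon. -/
def NonExplosive (t : ℝ) (z : State K M) : Prop :=
  ∀ α : Policy K M, ∀ᵐ ω ∂m.law α t z, {n | jumpTime (ω n) ≤ m.T}.Finite

lemma ae_jumpTime_le_jumpKernel (n : ℕ) (x : Node K M) :
    ∀ᵐ y ∂m.jumpKernel α n x, jumpTime x ≤ jumpTime y := by
  rcases x with p | _
  · exact m.ae_jumpTime_le_nextJump p _
  · exact (ae_dirac_iff (measurableSet_le measurable_const measurable_jumpTime)).2 le_rfl

lemma ae_jumpTime_zero : ∀ᵐ ω ∂m.law α t z, jumpTime (ω 0) = t := by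
  rw [law_eq_markovLaw]
  exact ae_zero_markovLaw.mono fun ω hω => by rw [hω, jumpTime_inl]

lemma ae_monotone_jumpTime : ∀ᵐ ω ∂m.law α t z, Monotone fun n => jumpTime (ω n) :=
  (ae_markovLaw_succ (R := fun _ => {q | jumpTime q.1 ≤ jumpTime q.2})
    (fun _ => measurableSet_le (by fun_prop) (by fun_prop))
    (m.ae_jumpTime_le_jumpKernel α)).mono fun _ hω => monotone_nat_of_le_succ hω

variable {m} in
lemma NonExplosive.ae_regular (h : m.NonExplosive t z) :
    ∀ᵐ ω ∂m.law α t z, Regular ω t m.T := by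
  filter_upwards [m.ae_jumpTime_zero α, m.ae_monotone_jumpTime α, h α] with ω hzero hmono hfin
  exact ⟨hzero, hmono, hfin⟩

/-- The rewards are measurable and nonnegative, so that their expectations need no splitting. -/
structure NonnegRewards (m : Model K M) : Prop where
  measurable_f : ∀ a, Measurable (m.f a)
  measurable_g : Measurable m.g
  f_nonneg : ∀ a z, 0 ≤ m.f a z
  g_nonneg : ∀ z, 0 ≤ m.g z

/-- Expected total reward of the decision process when the rewards are nonnegative, computed on the
chain of the continuous-time problem; nothing is collected after the horizon. -/
def totalReward (t : ℝ) (z : State K M) : ℝ≥0∞ :=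
  ∑' n, ∫⁻ ω, ENNReal.ofReal (m.nodeReward α n (ω n)) ∂m.law α t z

variable {m}

lemma nonnegRewards_positivePart (hf : ∀ a, Measurable (m.f a)) (hg : Measurable m.g) :
    m.positivePart.NonnegRewards :=
  ⟨fun a => (hf a).max measurable_const, hg.max measurable_const, fun _ _ => posPart_nonneg _,
    fun _ => posPart_nonneg _⟩

lemma nonnegRewards_negativePart (hf : ∀ a, Measurable (m.f a)) (hg : Measurable m.g) :
    m.negativePart.NonnegRewards :=
  ⟨fun a => (hf a).neg.max measurable_const, hg.neg.max measurable_const,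
    fun _ _ => negPart_nonneg _, fun _ => negPart_nonneg _⟩

namespace NonnegRewards

lemma nodeReward_nonneg (h : m.NonnegRewards) (n : ℕ) (x : Node K M) : 0 ≤ m.nodeReward α n x := by
  have hterm : ∀ (r : ℝ) z, 0 ≤ Real.exp r * m.g z := fun r z =>
    mul_nonneg (Real.exp_pos r).le (h.g_nonneg z)
  rcases x with p | _
  · change 0 ≤ m.reward p.1 p.2 (α.rule n p)
    simp only [reward]
    split_ifs with hp hrate
    · exact add_nonneg (mul_nonneg (h.f_nonneg _ _) (sub_nonneg.2 hp)) (hterm _ _)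
    · have hpos : (0 : ℝ) < m.totalRate p.2.2 := (NNReal.coe_nonneg _).lt_of_ne' hrate
      exact add_nonneg (mul_nonneg (h.f_nonneg _ _)
        (one_div_sub_exp_div_nonneg hpos (sub_nonneg.2 hp))) (hterm _ _)
    · exact le_rfl
  · exact le_rfl

lemma ae_periodReward_nonneg (h : m.NonnegRewards) (n : ℕ) :
    ∀ᵐ ω ∂m.law α t z, 0 ≤ m.periodReward α n (ω n) (ω (n + 1)) :=
  (m.ae_monotone_jumpTime α).mono fun _ hmono =>
    m.periodReward_nonneg α h.f_nonneg h.g_nonneg (hmono n.le_succ)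

lemma tsum_lintegral_periodReward (h : m.NonnegRewards) :
    ∑' n, ∫⁻ ω, ENNReal.ofReal (m.periodReward α n (ω n) (ω (n + 1))) ∂m.law α t z
      = m.totalReward α t z := by
  refine tsum_congr fun n => ?_
  rw [law_eq_markovLaw, lintegral_markovLaw_succ n
    (m.measurable_periodReward α h.measurable_f h.measurable_g n).ennreal_ofReal]
  simp only [m.lintegral_periodReward α h.f_nonneg h.g_nonneg]

lemma lintegral_ofReal_reward (h : m.NonnegRewards) (ht : t ≤ m.T)
    (hexp : m.NonExplosive t z) :
    ∫⁻ ω, ENNReal.ofReal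
        ((∫ s in t..m.T, m.f (current α ω s).1 (current α ω s).2) + m.g (current α ω m.T).2)
          ∂m.law α t z = m.totalReward α t z := by
  have hsum := (hexp.ae_regular α).mono fun ω hω => m.hasSum_periodReward α hω ht
  rw [← h.tsum_lintegral_periodReward α, ← lintegral_ofReal_tsum
    (m.measurable_periodReward_chain α h.measurable_f h.measurable_g)
    (h.ae_periodReward_nonneg α) (hsum.mono fun ω hω => hω.summable)]
  exact lintegral_congr_ae (hsum.mono fun ω hω => by simp only [hω.tsum_eq])

end NonnegRewards

lemma totalReward_positivePart_ne_top (hf : ∀ a, Measurable (m.f a)) (hg : Measurable m.g)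
    (ht : t ≤ m.T) (hexp : m.NonExplosive t z)
    (hpos : ∫⁻ ω, ((∫⁻ s in Icc t m.T, ENNReal.ofReal (m.f (current α ω s).1 (current α ω s).2))
      + ENNReal.ofReal (m.g (current α ω m.T).2)) ∂m.law α t z ≠ ∞) :
    m.positivePart.totalReward α t z ≠ ∞ := by
  rw [← (nonnegRewards_positivePart hf hg).lintegral_ofReal_reward α ht hexp]
  refine ne_top_of_le_ne_top hpos (lintegral_mono fun ω => ?_)
  have hnorm : ∀ x : ℝ, ENNReal.ofReal x⁺ = ENNReal.ofReal x := fun x => by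
    rw [posPart_def, ENNReal.ofReal_max, ENNReal.ofReal_zero, max_eq_left (zero_le)]
  refine ENNReal.ofReal_add_le.trans (add_le_add ?_ (hnorm _).le)
  change ENNReal.ofReal (∫ s in t..m.T, (m.f (current α ω s).1 (current α ω s).2)⁺) ≤ _
  rw [intervalIntegral.integral_of_le ht, ← integral_Icc_eq_integral_Ioc]
  refine (Real.ofReal_le_enorm _).trans ((enorm_integral_le_lintegral_enorm _).trans_eq ?_)
  refine lintegral_congr fun s => ?_
  rw [Real.enorm_of_nonneg (posPart_nonneg _), hnorm]

lemma expectation_law (hf : ∀ a, Measurable (m.f a)) (hg : Measurable m.g) (ht : t ≤ m.T)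
    (hexp : m.NonExplosive t z) (hpos : m.positivePart.totalReward α t z ≠ ∞) :
    expectation (m.law α t z) (fun ω =>
        (∫ s in t..m.T, m.f (current α ω s).1 (current α ω s).2) + m.g (current α ω m.T).2)
      = (m.positivePart.totalReward α t z : EReal) - m.negativePart.totalReward α t z := by
  have hplus := nonnegRewards_positivePart hf hg
  have hminus := nonnegRewards_negativePart hf hg
  have hregular := hexp.ae_regular α
  have hdecomp : (fun ω => (∫ s in t..m.T, m.f (current α ω s).1 (current α ω s).2)
      + m.g (current α ω m.T).2) =ᵐ[m.law α t z] fun ω =>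
        ∑' n, (m.positivePart.periodReward α n (ω n) (ω (n + 1))
          - m.negativePart.periodReward α n (ω n) (ω (n + 1))) := by
    filter_upwards [hregular] with ω hω
    simp only [← periodReward_eq_sub]
    exact (m.hasSum_periodReward α hω ht).tsum_eq.symm
  rw [← hplus.tsum_lintegral_periodReward α] at hpos ⊢
  rw [← hminus.tsum_lintegral_periodReward α, expectation_congr_ae hdecomp]
  exact expectation_tsum_sub
    (m.positivePart.measurable_periodReward_chain α hplus.measurable_f hplus.measurable_g)
    (m.negativePart.measurable_periodReward_chain α hminus.measurable_f hminus.measurable_g)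
    (hplus.ae_periodReward_nonneg α) (hminus.ae_periodReward_nonneg α)
    (hregular.mono fun ω hω => (m.positivePart.hasSum_periodReward α hω ht).summable)
    (hregular.mono fun ω hω => (m.negativePart.hasSum_periodReward α hω ht).summable) hpos

lemma expectation_mdpChain (hf : ∀ a, Measurable (m.f a)) (hg : Measurable m.g) (ht : t ≤ m.T)
    (hexp : m.NonExplosive t z) (hpos : m.positivePart.totalReward α t z ≠ ∞) :
    expectation (m.mdpChain α t z) (fun ω => ∑' n, m.stepReward α ω n)
      = (m.positivePart.totalReward α t z : EReal) - m.negativePart.totalReward α t z := by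
  have hplus := nonnegRewards_positivePart hf hg
  have hminus := nonnegRewards_negativePart hf hg
  have hregular := hexp.ae_regular α
  have hmeas : ∀ m' : Model K M, (∀ a, Measurable (m'.f a)) → Measurable m'.g → ∀ n,
      Measurable fun ω : ℕ → Node K M => m'.nodeReward α n (ω n) := fun m' hf hg n =>
    (m'.measurable_nodeReward α hf hg n).comp (measurable_pi_apply n)
  have hkill : (fun ω => ∑' n, m.nodeReward α n (ω n)) ∘ (fun ω n => kill m.T (ω n))
      = fun ω : ℕ → Node K M => ∑' n, (m.positivePart.nodeReward α n (ω n)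
        - m.negativePart.nodeReward α n (ω n)) := by
    simp only [← nodeReward_eq_sub]
    exact funext fun ω => tsum_congr fun n => m.nodeReward_kill α n (ω n)
  have hmkill : Measurable fun (ω : ℕ → Node K M) n => kill m.T (ω n) :=
    measurable_pi_lambda _ fun n => (measurable_kill m.T).comp (measurable_pi_apply n)
  simp only [stepReward_eq_nodeReward]
  rw [m.mdpChain_eq_map_kill_law α ht z, expectation_map hmkill
    (Measurable.tsum (hmeas m hf hg)), hkill]
  exact expectation_tsum_sub (hmeas _ hplus.measurable_f hplus.measurable_g)
    (hmeas _ hminus.measurable_f hminus.measurable_g)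
    (fun n => .of_forall fun ω => hplus.nodeReward_nonneg α n (ω n))
    (fun n => .of_forall fun ω => hminus.nodeReward_nonneg α n (ω n))
    (hregular.mono fun ω hω => m.positivePart.summable_nodeReward α hω)
    (hregular.mono fun ω hω => m.negativePart.summable_nodeReward α hω) hpos

end Model

/-! ### Growth of the book -/

namespace Side

variable (s : Side K M)

lemma vol_shift_le (d : ℤ) {vInf V : ℕ} (hInf : vInf ≤ V) (h : ∀ i, s.vol i ≤ V) (i : Fin K) :
    (s.shift d vInf).vol i ≤ V := by
  simp only [shift]
  split_ifs
  exacts [Nat.zero_le _, h _, hInf]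

lemma vol_add_le (i j : Fin K) : (s.add i).vol j ≤ s.vol j + 1 := by
  rcases eq_or_ne j i with rfl | hji <;> simp [add, *]

lemma vol_cancel_le (i : Fin K) (k : ℕ) (j : Fin K) : (s.cancel i k).vol j ≤ s.vol j := by
  rcases eq_or_ne j i with rfl | hji <;> simp [cancel, *]

lemma vol_execute_le (i : Fin K) : s.execute.vol i ≤ s.vol i := by
  simp only [execute]
  split_ifs
  exacts [Nat.sub_le _ _, le_rfl]

end Side

namespace Model

variable (m : Model K M)

/-- Size of a book: the largest number of orders of general participants at a limit, be it inside
or outside the frame. -/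
def size (c : Config K M) : ℕ :=
  max (max m.askInf m.bidInf) (Finset.univ.sup fun i => max (c.ask.vol i) (c.bid.vol i))

lemma size_le_iff {c : Config K M} {V : ℕ} :
    m.size c ≤ V ↔ (m.askInf ≤ V ∧ m.bidInf ≤ V) ∧ ∀ i, c.ask.vol i ≤ V ∧ c.bid.vol i ≤ V := by
  simp [size, and_assoc]

lemma size_setAsk_le {y : State K M} {s : Side K M} {V : ℕ} (hy : m.size y.2 ≤ V)
    (hs : ∀ i, s.vol i ≤ V) : m.size (m.setAsk y s).2 ≤ V := by
  obtain ⟨hInf, hvol⟩ := m.size_le_iff.1 hy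
  exact m.size_le_iff.2
    ⟨hInf, fun i => ⟨hs i, Side.vol_shift_le _ _ hInf.2 (fun j => (hvol j).2) i⟩⟩

lemma size_setBid_le {y : State K M} {s : Side K M} {V : ℕ} (hy : m.size y.2 ≤ V)
    (hs : ∀ i, s.vol i ≤ V) : m.size (m.setBid y s).2 ≤ V := by
  obtain ⟨hInf, hvol⟩ := m.size_le_iff.1 hy
  exact m.size_le_iff.2
    ⟨hInf, fun i => ⟨Side.vol_shift_le _ _ hInf.1 (fun j => (hvol j).1) i, hs i⟩⟩

lemma size_outcome_le (e : Event K) (k : ℕ) (y : State K M) :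
    m.size (m.outcome e k y).2 ≤ m.size y.2 + 1 := by
  classical
  have hy := Nat.le_succ (m.size y.2)
  obtain ⟨-, hvol⟩ := m.size_le_iff.1 (le_refl (m.size y.2))
  have hask : ∀ i, y.2.ask.vol i ≤ m.size y.2 + 1 := fun i => (hvol i).1.trans hy
  have hbid : ∀ i, y.2.bid.vol i ≤ m.size y.2 + 1 := fun i => (hvol i).2.trans hy
  cases e with
  | marketBuy =>
    refine m.size_setAsk_le ?_ fun i => (y.2.ask.vol_execute_le i).trans (hask i)
    split_ifs <;> exact hy
  | marketSell =>
    refine m.size_setBid_le ?_ fun i => (y.2.bid.vol_execute_le i).trans (hbid i)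
    split_ifs <;> exact hy
  | limitAsk i =>
    exact m.size_setAsk_le hy fun j => (y.2.ask.vol_add_le i j).trans (by have := hvol j; omega)
  | limitBid i =>
    exact m.size_setBid_le hy fun j => (y.2.bid.vol_add_le i j).trans (by have := hvol j; omega)
  | cancelAsk i =>
    exact m.size_setAsk_le hy fun j => (y.2.ask.vol_cancel_le i k j).trans (hask j)
  | cancelBid i =>
    exact m.size_setBid_le hy fun j => (y.2.bid.vol_cancel_le i k j).trans (hbid j)

lemma ae_size_jumpLaw_le (y : State K M) (a : Action K M) :
    ∀ᵐ y' ∂m.jumpLaw y a, m.size y'.2 ≤ m.size y.2 + 1 := by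
  refine ae_finsetSum_measure_iff.2 fun e _ => Measure.ae_smul_measure ?_ _
  refine ae_finsetSum_measure_iff.2 fun k _ => Measure.ae_smul_measure ?_ _
  have hset : MeasurableSet {y' : State K M | m.size y'.2 ≤ m.size y.2 + 1} :=
    measurable_snd (MeasurableSet.of_discrete (s := {c | m.size c ≤ m.size y.2 + 1}))
  exact (ae_dirac_iff hset).2 (m.size_outcome_le e k (afterDecision a y))

variable {m} in
lemma LinearIntensities.exists_totalRate_le (h : m.LinearIntensities) :
    ∃ L : ℝ, 0 < L ∧ ∀ c : Config K M, (m.totalRate c : ℝ) ≤ L * (m.size c + 1) := by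
  obtain ⟨C, hC⟩ := h
  refine ⟨Fintype.card (Event K) * (|C| * (1 + 2 * K)) + 1, by positivity, fun c => ?_⟩
  obtain ⟨-, hvol⟩ := m.size_le_iff.1 (le_refl (m.size c))
  have hsum : ∀ v : Fin K → ℕ, (∀ i, v i ≤ m.size c) → ∑ i, (v i : ℝ) ≤ K * m.size c := by
    intro v hv
    have := Finset.sum_le_card_nsmul Finset.univ v (m.size c) fun i _ => hv i
    simp only [Finset.card_univ, Fintype.card_fin, smul_eq_mul] at this
    exact_mod_cast this
  have hask := hsum c.ask.vol fun i => (hvol i).1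
  have hbid := hsum c.bid.vol fun i => (hvol i).2
  have hrate : ∀ e, (m.rate e c : ℝ) ≤ |C| * (1 + 2 * K) * (m.size c + 1) := fun e =>
    calc (m.rate e c : ℝ) ≤ C * (1 + ∑ i, (c.ask.vol i : ℝ) + ∑ i, (c.bid.vol i : ℝ)) := hC e _ _
      _ ≤ |C| * (1 + ∑ i, (c.ask.vol i : ℝ) + ∑ i, (c.bid.vol i : ℝ)) := by
        gcongr
        exact le_abs_self C
      _ ≤ |C| * ((1 + 2 * K) * (m.size c + 1)) := by
        gcongr
        have : (0 : ℝ) ≤ m.size c := Nat.cast_nonneg _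
        have : (0 : ℝ) ≤ K := Nat.cast_nonneg _
        nlinarith
      _ = |C| * (1 + 2 * K) * (m.size c + 1) := by ring
  calc (m.totalRate c : ℝ) = ∑ e, (m.rate e c : ℝ) := by rw [totalRate, NNReal.coe_sum]
    _ ≤ ∑ _e : Event K, |C| * (1 + 2 * K) * ((m.size c : ℝ) + 1) :=
      Finset.sum_le_sum fun e _ => hrate e
    _ = Fintype.card (Event K) * (|C| * (1 + 2 * K)) * ((m.size c : ℝ) + 1) := by
      rw [Finset.sum_const, Finset.card_univ, nsmul_eq_mul]
      ring
    _ ≤ _ := by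
      gcongr
      exact le_add_of_nonneg_right zero_le_one

/-- Size of the book at a node; zero at the cemetery. -/
def nodeSize : Node K M → ℕ := Sum.elim (fun p => m.size p.2.2) fun _ => 0

/-- Total intensity at a node; zero at the cemetery, from where no jump occurs. -/
def nodeRate : Node K M → ℝ≥0 := Sum.elim (fun p => m.totalRate p.2.2) fun _ => 0

lemma measurable_nodeSize : Measurable m.nodeSize :=
  Measurable.sumElim ((Measurable.of_discrete (f := m.size)).comp (by fun_prop)) measurable_const

lemma ae_nodeSize_jumpKernel_le (α : Policy K M) (n : ℕ) (x : Node K M) :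
    ∀ᵐ y ∂m.jumpKernel α n x, m.nodeSize y ≤ m.nodeSize x + 1 := by
  have hset : MeasurableSet {y | m.nodeSize y ≤ m.nodeSize x + 1} :=
    measurableSet_le m.measurable_nodeSize measurable_const
  rcases x with p | _
  · exact m.ae_nextJump hset (Nat.zero_le _)
      ((m.ae_size_jumpLaw_le p.2 _).mono fun y hy _ _ => hy)
  · exact (ae_dirac_iff hset).2 (Nat.zero_le _)

lemma ae_nodeSize_le (α : Policy K M) (t : ℝ) (z : State K M) :
    ∀ᵐ ω ∂m.law α t z, ∀ n, m.nodeSize (ω n) ≤ m.size z.2 + n := by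
  rw [law_eq_markovLaw]
  have hmeas := m.measurable_nodeSize
  have hstep : ∀ᵐ ω ∂markovLaw (m.jumpKernel α) (Sum.inl (t, z)),
      ∀ n, m.nodeSize (ω (n + 1)) ≤ m.nodeSize (ω n) + 1 :=
    ae_markovLaw_succ (R := fun _ => {q | m.nodeSize q.2 ≤ m.nodeSize q.1 + 1})
      (fun _ => measurableSet_le (by fun_prop) (by fun_prop)) (m.ae_nodeSize_jumpKernel_le α)
  filter_upwards [ae_zero_markovLaw, hstep] with ω hzero hsucc n
  induction n with
  | zero => exact (congrArg m.nodeSize hzero).le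
  | succ n ih => exact (hsucc n).trans (Nat.succ_le_succ ih)

variable {m} in
lemma LinearIntensities.exists_ae_nodeRate_le (h : m.LinearIntensities) (α : Policy K M) (t : ℝ)
    (z : State K M) :
    ∃ L : ℝ, 0 < L ∧ ∀ᵐ ω ∂m.law α t z, ∀ n : ℕ, (m.nodeRate (ω n) : ℝ) ≤ L * (n + 1) := by
  obtain ⟨L, hL, hrate⟩ := h.exists_totalRate_le
  refine ⟨L * (m.size z.2 + 1), by positivity, (m.ae_nodeSize_le α t z).mono fun ω hω n => ?_⟩
  have hnode : (m.nodeRate (ω n) : ℝ) ≤ L * (m.nodeSize (ω n) + 1) := by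
    rcases ω n with p | _
    · exact hrate p.2.2
    · simpa [nodeRate, nodeSize] using hL.le
  have hsize : (m.nodeSize (ω n) : ℝ) ≤ m.size z.2 + n := by exact_mod_cast hω n
  refine hnode.trans ?_
  rw [mul_assoc]
  gcongr
  nlinarith [(m.size z.2).cast_nonneg (α := ℝ), n.cast_nonneg (α := ℝ)]

end Model

/-! ### Tails of the number of arrivals -/

/-- The discount factor `e^{-s τ}`; it vanishes at `τ = ∞` for `s > 0`. -/
def discount (s : ℝ) (τ : EReal) : ℝ≥0∞ := (-(s * τ)).exp

lemma discount_coe (s r : ℝ) : discount s r = ENNReal.ofReal (Real.exp (-(s * r))) := by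
  rw [discount, ← EReal.coe_mul, ← EReal.coe_neg, EReal.exp_coe]

lemma discount_top {s : ℝ} (hs : 0 < s) : discount s ⊤ = 0 := by
  rw [discount, EReal.coe_mul_top_of_pos hs, EReal.neg_top, EReal.exp_bot]

lemma antitone_discount {s : ℝ} (hs : 0 ≤ s) : Antitone (discount s) := fun _ _ h =>
  EReal.exp_monotone (EReal.neg_le_neg_iff.2 (mul_le_mul_of_nonneg_left h (EReal.coe_nonneg.2 hs)))

lemma one_div_choose_mul (n k : ℕ) :
    (1 / (n + k).choose k : ℝ) * ((n + 1) / (n + 1 + k)) = 1 / (n + 1 + k).choose k := by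
  have hpascal := Nat.choose_mul_succ_eq (n + k) k
  rw [show n + k + 1 = n + 1 + k by ring, Nat.add_sub_cancel] at hpascal
  have hpos : ((n + k).choose k : ℝ) ≠ 0 :=
    Nat.cast_ne_zero.2 (Nat.choose_pos (Nat.le_add_left k n)).ne'
  have hpos' : ((n + 1 + k).choose k : ℝ) ≠ 0 :=
    Nat.cast_ne_zero.2 (Nat.choose_pos (Nat.le_add_left k _)).ne'
  field_simp
  exact_mod_cast (by linarith : (n + 1) * (n + 1 + k).choose k = (n + k).choose k * (n + 1 + k))

lemma one_div_choose_le (n k : ℕ) :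
    1 / ((n + k).choose k : ℝ) ≤ k.factorial / (n + 1) ^ k := by
  have hpow := Nat.pow_le_choose (α := ℝ) k (n + k)
  rw [show n + k + 1 - k = n + 1 by omega] at hpow
  push_cast at hpow
  have := one_div_le_one_div_of_le (by positivity) hpow
  rwa [one_div_div] at this

namespace Model

variable (m : Model K M) (α : Policy K M) (t : ℝ) (z : State K M)

lemma lintegral_discount_jumpKernel {s : ℝ} (hs : 0 < s) (n : ℕ) (x : Node K M) :
    ∫⁻ y, discount s (jumpTime y) ∂m.jumpKernel α n x
      = discount s (jumpTime x) * ENNReal.ofReal (m.nodeRate x / (m.nodeRate x + s)) := by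
  have hmeas := (antitone_discount hs.le).measurable
  have hcemetery : ∫⁻ y, discount s (jumpTime y) ∂Measure.dirac (.inr () : Node K M) = 0 := by
    rw [lintegral_dirac' _ (by fun_prop), jumpTime_inr, discount_top hs]
  rcases x with p | _
  · change ∫⁻ y, discount s (jumpTime y) ∂m.nextJump p (α.rule n p) = discount s p.1
      * ENNReal.ofReal (m.totalRate p.2.2 / (m.totalRate p.2.2 + s))
    by_cases h : m.totalRate p.2.2 = 0
    · simp [m.nextJump_of_totalRate_eq_zero h, hcemetery, h]
    · have hsplit : ∀ r : ℝ, discount s ((p.1 + r : ℝ) : EReal)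
          = discount s p.1 * ENNReal.ofReal (Real.exp (-(s * r))) := fun r => by
        rw [discount_coe, discount_coe, ← ENNReal.ofReal_mul (Real.exp_pos _).le, ← Real.exp_add]
        ring_nf
      rw [m.lintegral_jumpTime_nextJump h hmeas]
      simp only [hsplit]
      rw [lintegral_const_mul _ (by fun_prop),
        laplace_expMeasure (NNReal.coe_pos.2 (pos_iff_ne_zero.2 h)) hs.le]
  · refine Eq.trans hcemetery ?_
    rw [jumpTime_inr, discount_top hs, zero_mul]

/-- With rates at most `L (n + 1)`, the factor of step `n` is at most `(n + 1) / (n + 1 + k)`; the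
product of these factors is the reciprocal of a binomial coefficient. -/
lemma lintegral_discount_law_le {L : ℝ} (hL : 0 < L)
    (hrate : ∀ᵐ ω ∂m.law α t z, ∀ n : ℕ, (m.nodeRate (ω n) : ℝ) ≤ L * (n + 1)) {k : ℕ}
    (hk : 0 < k) (n : ℕ) :
    ∫⁻ ω, discount (L * k) (jumpTime (ω n)) ∂m.law α t z
      ≤ discount (L * k) t * ENNReal.ofReal (1 / (n + k).choose k) := by
  have hs : 0 < L * k := by positivity
  have hmeas : Measurable fun x : Node K M => discount (L * k) (jumpTime x) :=
    (antitone_discount hs.le).measurable.comp measurable_jumpTime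
  induction n with
  | zero =>
    rw [lintegral_congr_ae ((m.ae_jumpTime_zero α).mono fun ω h => congrArg (discount (L * k)) h)]
    simp
  | succ n ih =>
    have hfactor : ∀ᵐ ω ∂m.law α t z,
        ENNReal.ofReal (m.nodeRate (ω n) / (m.nodeRate (ω n) + L * k))
          ≤ ENNReal.ofReal ((n + 1) / (n + 1 + k)) := by
      filter_upwards [hrate] with ω hω
      refine ENNReal.ofReal_le_ofReal ?_
      rw [div_le_div_iff₀ (by positivity) (by positivity)]
      nlinarith [hω n, (Nat.cast_pos (α := ℝ)).2 hk]
    calc ∫⁻ ω, discount (L * k) (jumpTime (ω (n + 1))) ∂m.law α t z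
        = ∫⁻ ω, discount (L * k) (jumpTime (ω n))
            * ENNReal.ofReal (m.nodeRate (ω n) / (m.nodeRate (ω n) + L * k)) ∂m.law α t z := by
          simp only [← m.lintegral_discount_jumpKernel α hs n]
          exact lintegral_markovLaw_succ (κ := m.jumpKernel α) n
            (H := fun q => discount (L * k) (jumpTime q.2))
            (hmeas.comp measurable_snd)
      _ ≤ ∫⁻ ω, discount (L * k) (jumpTime (ω n)) * ENNReal.ofReal ((n + 1) / (n + 1 + k))
            ∂m.law α t z := lintegral_mono_ae (hfactor.mono fun ω h => by gcongr)
      _ = (∫⁻ ω, discount (L * k) (jumpTime (ω n)) ∂m.law α t z)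
            * ENNReal.ofReal ((n + 1) / (n + 1 + k)) :=
          lintegral_mul_const _ (hmeas.comp (measurable_pi_apply n))
      _ ≤ discount (L * k) t * ENNReal.ofReal (1 / (n + k).choose k)
            * ENNReal.ofReal ((n + 1) / (n + 1 + k)) := by gcongr
      _ = discount (L * k) t * ENNReal.ofReal (1 / (n + 1 + k).choose k) := by
          rw [mul_assoc, ← ENNReal.ofReal_mul (by positivity), one_div_choose_mul]

variable {m}

lemma LinearIntensities.exists_law_jumpTime_le_le (h : m.LinearIntensities) {k : ℕ} (hk : 0 < k) :
    ∃ C : ℝ, ∀ n : ℕ,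
      m.law α t z {ω | jumpTime (ω n) ≤ m.T} ≤ ENNReal.ofReal (C / (n + 1) ^ k) := by
  obtain ⟨L, hL, hrate⟩ := h.exists_ae_nodeRate_le α t z
  have hs : 0 < L * k := by positivity
  have hmeas : Measurable fun x : Node K M => discount (L * k) (jumpTime x) :=
    (antitone_discount hs.le).measurable.comp measurable_jumpTime
  refine ⟨Real.exp (L * k * (m.T - t)) * k.factorial, fun n => ?_⟩
  have hmarkov : discount (L * k) m.T * m.law α t z {ω | jumpTime (ω n) ≤ m.T}
      ≤ discount (L * k) t * ENNReal.ofReal (1 / (n + k).choose k) :=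
    calc discount (L * k) m.T * m.law α t z {ω | jumpTime (ω n) ≤ m.T}
        ≤ discount (L * k) m.T
            * m.law α t z {ω | discount (L * k) m.T ≤ discount (L * k) (jumpTime (ω n))} := by
          gcongr with ω
          exact fun hω => antitone_discount hs.le hω
      _ ≤ ∫⁻ ω, discount (L * k) (jumpTime (ω n)) ∂m.law α t z :=
          mul_meas_ge_le_lintegral (hmeas.comp (measurable_pi_apply n)) _
      _ ≤ _ := m.lintegral_discount_law_le α t z hL hrate hk n
  rw [discount_coe, discount_coe, ← ENNReal.ofReal_mul (Real.exp_pos _).le, mul_comm,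
    ← ENNReal.le_div_iff_mul_le (by simp [Real.exp_pos]) (by simp),
    ← ENNReal.ofReal_div_of_pos (Real.exp_pos _)] at hmarkov
  refine hmarkov.trans (ENNReal.ofReal_le_ofReal ?_)
  calc Real.exp (-(L * k * t)) * (1 / (n + k).choose k) / Real.exp (-(L * k * m.T))
      = Real.exp (L * k * (m.T - t)) * (1 / (n + k).choose k) := by
        rw [mul_div_right_comm, ← Real.exp_sub]
        ring_nf
    _ ≤ Real.exp (L * k * (m.T - t)) * (k.factorial / (n + 1) ^ k) :=
        mul_le_mul_of_nonneg_left (one_div_choose_le n k) (Real.exp_pos _).le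
    _ = _ := by ring

lemma LinearIntensities.tsum_mul_law_jumpTime_le_ne_top (h : m.LinearIntensities) (c : ℝ)
    (d : ℕ) :
    ∑' n : ℕ, ENNReal.ofReal (c * (1 + n) ^ d) * m.law α t z {ω | jumpTime (ω n) ≤ m.T} ≠ ∞ := by
  obtain ⟨C, hle⟩ := h.exists_law_jumpTime_le_le α t z (k := d + 2) (by omega)
  have hsummable : Summable fun n : ℕ => |c| * C * (1 / ((n : ℝ) + 1) ^ 2) := by
    have := (summable_nat_add_iff 1).2 (Real.summable_one_div_nat_pow.2 one_lt_two)
    exact Summable.mul_left _ (by exact_mod_cast this)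
  refine ne_top_of_le_ne_top hsummable.tsum_ofReal_ne_top (ENNReal.tsum_le_tsum fun n => ?_)
  calc ENNReal.ofReal (c * (1 + n) ^ d) * m.law α t z {ω | jumpTime (ω n) ≤ m.T}
      ≤ ENNReal.ofReal (|c| * (1 + n) ^ d) * ENNReal.ofReal (C / (n + 1) ^ (d + 2)) := by
        gcongr
        exacts [le_abs_self c, hle n]
    _ = ENNReal.ofReal (|c| * C * (1 / ((n : ℝ) + 1) ^ 2)) := by
        rw [← ENNReal.ofReal_mul (by positivity), pow_add, add_comm (1 : ℝ)]
        congr 1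
        field_simp

lemma LinearIntensities.nonExplosive (h : m.LinearIntensities) : m.NonExplosive t z := fun α =>
  ae_finite_setOfPred_mem (s := fun n => {ω : ℕ → Node K M | jumpTime (ω n) ≤ m.T})
    (by simpa using h.tsum_mul_law_jumpTime_le_ne_top α t z 1 0)

variable {t z}

lemma LinearIntensities.exists_measurable_le_pow_arrivals (h : m.LinearIntensities) (ht : t ≤ m.T)
    (c : ℝ) (d : ℕ) :
    ∃ G : (ℕ → Node K M) → ℝ≥0∞, Measurable G ∧ ∫⁻ ω, G ω ∂m.law α t z ≠ ∞ ∧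
      ∀ᵐ ω ∂m.law α t z, ENNReal.ofReal (c * (1 + arrivals ω m.T) ^ d) ≤ G ω := by
  have hset : ∀ n, MeasurableSet {ω : ℕ → Node K M | jumpTime (ω n) ≤ m.T} := fun n =>
    measurableSet_le (by fun_prop) measurable_const
  have hterm : ∀ n : ℕ, Measurable ({ω : ℕ → Node K M | jumpTime (ω n) ≤ m.T}.indicator
      fun _ => ENNReal.ofReal (c * (1 + n) ^ d)) := fun n => measurable_const.indicator (hset n)
  refine ⟨fun ω => ∑' n : ℕ, {ω : ℕ → Node K M | jumpTime (ω n) ≤ m.T}.indicator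
    (fun _ => ENNReal.ofReal (c * (1 + n) ^ d)) ω, .tsum hterm, ?_, ?_⟩
  · rw [lintegral_tsum fun n => (hterm n).aemeasurable]
    simp only [lintegral_indicator_const (hset _)]
    exact h.tsum_mul_law_jumpTime_le_ne_top α t z c d
  · filter_upwards [(h.nonExplosive t z).ae_regular α] with ω hω
    refine le_trans ?_ (ENNReal.le_tsum (arrivals ω m.T))
    rw [indicator_of_mem (by exact (hω.arrivals_spec ht).1)]

lemma RewardBounds.lintegral_reward_ne_top (hb : m.RewardBounds t z) (h : m.LinearIntensities)
    (ht : t ≤ m.T) :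
    ∫⁻ ω, ((∫⁻ s in Icc t m.T, ENNReal.ofReal (m.f (current α ω s).1 (current α ω s).2))
      + ENNReal.ofReal (m.g (current α ω m.T).2)) ∂m.law α t z ≠ ∞ := by
  obtain ⟨hrunning, c, d, hterminal⟩ := hb
  obtain ⟨G, hG, hGfin, hle⟩ := h.exists_measurable_le_pow_arrivals α (z := z) ht c d
  have hsum := ENNReal.add_ne_top.2 ⟨((le_iSup _ α).trans_lt hrunning).ne, hGfin⟩
  rw [← lintegral_add_right _ hG] at hsum
  refine ne_top_of_le_ne_top hsum (lintegral_mono_ae ?_)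
  filter_upwards [hterminal α, hle] with ω hω hGω
  gcongr
  exact (ENNReal.ofReal_le_ofReal hω).trans hGω

end Model

end MarketMaking

end

open MarketMaking in
theorem proposition3p1_general {K M : ℕ} (m : Model K M) (hf : ∀ a, Measurable (m.f a))
    (hg : Measurable m.g) {t : ℝ} (ht : t ≤ m.T) {z : State K M} (hexp : m.NonExplosive t z)
    (hpos : ∀ α, ∫⁻ ω, ((∫⁻ s in Icc t m.T,
      ENNReal.ofReal (m.f (current α ω s).1 (current α ω s).2))
        + ENNReal.ofReal (m.g (current α ω m.T).2)) ∂m.law α t z ≠ ∞) :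
    m.mdpValue t z = m.value t z := by
  refine iSup_congr fun α => ?_
  have hfin := Model.totalReward_positivePart_ne_top α hf hg ht hexp (hpos α)
  rw [Model.expectation_mdpChain α hf hg ht hexp hfin, Model.expectation_law α hf hg ht hexp hfin]

/-- The value function of the continuous-time market-making problem coincides with the value function
of the associated discrete-time Markov decision process with infinite horizon. -/
theorem proposition3p1 {K M : ℕ} (m : MarketMaking.Model K M)
    (hintensity : m.LinearIntensities)
    (hf : ∀ a, Measurable (m.f a)) (hg : Measurable m.g)
    (hrewards : ∀ t ∈ Set.Icc 0 m.T, ∀ z, m.RewardBounds t z) :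
    ∀ t ∈ Set.Icc 0 m.T, ∀ z : MarketMaking.State K M, m.mdpValue t z = m.value t z :=
  fun t ht z => proposition3p1_general m hf hg ht.2 (hintensity.nonExplosive t z) fun α =>
    (hrewards t ht z).lintegral_reward_ne_top α hintensity ht.2
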